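/- Let $G$ be a Polish group. A $G$-flow is a compact Hausdorff space with a continuous action of $G$. An affine $G$-flow is a compact convex subset $K$ of a Hausdorff locally convex real topological vector space together with a continuous action of $G$ on $K$ by affine homeomorphisms; an affine subflow of $K$ is a nonempty compact convex $G$-invariant subset, and $\overline{\mathrm{ext}}(K)$ is the closure of the set of extreme points of $K$. For a $G$-flow $X$, $P(X)$ is the affine $G$-flow of regular Borel probability measures on $X$, with the weak-$*$ topology and the push-forward action. An affine extension $\phi\colon K\to L$ of affine $G$-flows is a continuous, affine, $G$-equivariant surjection. It is proximally irreducible if every affine subflow $C\subseteq K$ with $$C\cap \mathrm{conv}\bigl(\overline{\mathrm{ext}}(K)\cap\phi^{-1}(\{y\})\bigr)\neq\emptyset\quad\text{for all }y\in\overline{\mathrm{ext}}(L)$$ is equal to $K$ (here $\mathrm{conv}$ is the convex hull, not closed). An affine $G$-flow $K$ is proximally irreducible if every proximally irreducible extension $P\to K$ is an isomorphism. A maximal proximally irreducible extension of $L$ is a proximally irreducible extension $\phi\colon K\to L$ for which the affine $G$-flow $K$ is proximally irreducible. 1. (Existence.) Let $L$ be an affine $G$-flow such that, whenever $\phi\colon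 K\to L$ and $\psi\colon P\to K$ are proximally irreducible extensions of affine $G$-flows, $\phi\circ\psi\colon P\to L$ is also proximally irreducible. Then there are a $G$-flow $X$ and a maximal proximally irreducible extension $\phi\colon P(X)\to L$. 2. (Uniqueness.) Let $L$ be an affine $G$-flow. If $\phi\colon K\to L$ and $\psi\colon K'\to L$ are maximal proximally irreducible extensions, then there is an isomorphism of affine $G$-flows $\eta\colon K\to K'$ with $\psi\circ\eta=\phi$. If moreover $K=P(X)$ and $K'=P(Z)$ for $G$-flows $X$ and $Z$, then $X$ and $Z$ are isomorphic $G$-flows. 3. (Examples.) If $Y$ is a $G$-flow that is minimal (every orbit is dense) or has a comeager orbit, then $L=P(Y)$ satisfies the hypothesis of part 1. -/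

import Mathlib

open Set Topology MeasureTheory

universe u

/-- A `G`-flow: a compact Hausdorff space with a (jointly) continuous left action of `G`. -/
structure GFlow (G : Type u) [Group G] [TopologicalSpace G] where
  carrier : Type u
  [top : TopologicalSpace carrier]
  [compact : CompactSpace carrier]
  [t2 : T2Space carrier]
  [action : MulAction G carrier]
  [cont : ContinuousSMul G carrier]

namespace GFlow

variable {G : Type u} [Group G] [TopologicalSpace G]

instance : CoeSort (GFlow G) (Type u) := ⟨GFlow.carrier⟩

attribute [instance] GFlow.top GFlow.compact GFlow.t2 GFlow.action GFlow.cont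

end GFlow

/-- A map between subsets of real vector spaces (thought of as convex sets) is affine when it
preserves the convex combinations that lie in the domain. -/
def PreservesConvexComb {E F : Type u} [AddCommGroup E] [Module ℝ E] [AddCommGroup F] [Module ℝ F]
    {s : Set E} {t : Set F} (f : s → t) : Prop :=
  ∀ (x y z : s) (a b : ℝ), 0 ≤ a → 0 ≤ b → a + b = 1 →
    (z : E) = a • (x : E) + b • (y : E) → (f z : F) = a • (f x : F) + b • (f y : F)

/-- An affine `G`-flow: a compact convex subset of a Hausdorff locally convex real topological
vector space with a (jointly) continuous left action of `G` by affine maps. The action is an action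
on the compact convex set only, not on the ambient space. -/
structure AffineFlow (G : Type u) [Group G] [TopologicalSpace G] where
  E : Type u
  [addCommGroup : AddCommGroup E]
  [module : Module ℝ E]
  [top : TopologicalSpace E]
  [addGroup : IsTopologicalAddGroup E]
  [contSMul : ContinuousSMul ℝ E]
  [locallyConvex : LocallyConvexSpace ℝ E]
  [t2 : T2Space E]
  carrier : Set E
  isCompact : IsCompact carrier
  convex : Convex ℝ carrier
  [action : MulAction G carrier]
  [cont : ContinuousSMul G carrier]
  affine : ∀ g : G, PreservesConvexComb (fun x : carrier => g • x)

namespace AffineFlow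

variable {G : Type u} [Group G] [TopologicalSpace G]

instance : CoeSort (AffineFlow G) (Type u) := ⟨fun K => K.carrier⟩

attribute [instance] AffineFlow.addCommGroup AffineFlow.module AffineFlow.top AffineFlow.addGroup
  AffineFlow.contSMul AffineFlow.locallyConvex AffineFlow.t2 AffineFlow.action AffineFlow.cont

/-- The closure of the set of extreme points of `K`. Since `K` is compact it is contained in `K`,
and it is the same whether the closure is taken in `K` or in the ambient space. -/
def extClosure (K : AffineFlow G) : Set K.E := closure (K.carrier.extremePoints ℝ)

/-- An affine subflow: a nonempty, compact, convex, `G`-invariant subset. -/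
structure IsAffineSubflow (K : AffineFlow G) (C : Set K.E) : Prop where
  subset : C ⊆ K.carrier
  nonempty : C.Nonempty
  isCompact : IsCompact C
  convex : Convex ℝ C
  smul_mem : ∀ (g : G) (x : K), (x : K.E) ∈ C → ((g • x : K) : K.E) ∈ C

/-- An affine extension: a surjective continuous `G`-equivariant affine map. -/
structure IsAffineExtension {K L : AffineFlow G} (φ : K → L) : Prop where
  continuous : Continuous φ
  map_smul : ∀ (g : G) (x : K), φ (g • x) = g • φ x
  affine : PreservesConvexComb φ
  surjective : Function.Surjective φ

/-- A proximally irreducible extension `φ : K → L`: an affine extension such that the only affine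
subflow `C` of `K` that meets the convex hull (without closure) of `extClosure K ∩ φ ⁻¹ {y}` for
every `y` in `extClosure L` is `K` itself. -/
structure IsProxIrrExtension {K L : AffineFlow G} (φ : K → L) : Prop
    extends IsAffineExtension φ where
  eq_of_meets : ∀ C : Set K.E, K.IsAffineSubflow C →
    (∀ y : L, (y : L.E) ∈ L.extClosure →
      (C ∩ convexHull ℝ (Subtype.val '' {x : K | (x : K.E) ∈ K.extClosure ∧ φ x = y})).Nonempty) →
    C = K.carrier

/-- An isomorphism of affine flows: a bijective affine extension (its inverse is then continuous,
equivariant and affine as well). -/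
structure IsAffineIso {K L : AffineFlow G} (φ : K → L) : Prop extends IsAffineExtension φ where
  injective : Function.Injective φ

/-- `K` is proximally irreducible: it has no nontrivial proximally irreducible extension, i.e.
each of its proximally irreducible extensions is an isomorphism. -/
def IsProxIrr (K : AffineFlow G) : Prop :=
  ∀ (P : AffineFlow G) (ψ : P → K), IsProxIrrExtension ψ → IsAffineIso ψ

/-- `φ : K → L` is a maximal proximally irreducible extension of `L`: it is a proximally
irreducible extension and `K` is proximally irreducible. -/
def IsMaxProxIrrExtension {K L : AffineFlow G} (φ : K → L) : Prop :=
  IsProxIrrExtension φ ∧ K.IsProxIrr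

/-- The composition of proximally irreducible extensions into `L` stays proximally irreducible. -/
def ComposesProxIrr (L : AffineFlow G) : Prop :=
  ∀ (K P : AffineFlow G) (φ : K → L) (ψ : P → K),
    IsProxIrrExtension φ → IsProxIrrExtension ψ → IsProxIrrExtension (φ ∘ ψ)

end AffineFlow

/-- `P(X)`: the regular Borel probability measures on `X`, viewed as a subset of `C(X)^*` with the
weak-* topology by identifying a measure `μ` with the functional `f ↦ ∫ f dμ`. -/
def regularProb (X : Type u) [TopologicalSpace X] [CompactSpace X] : Set (WeakDual ℝ C(X, ℝ)) :=
  letI : MeasurableSpace X := borel X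
  {Λ | ∃ μ : Measure X, μ.Regular ∧ IsProbabilityMeasure μ ∧ ∀ f : C(X, ℝ), Λ f = ∫ x, f x ∂μ}

section regularProb

variable {X : Type u} [TopologicalSpace X] [CompactSpace X] [T2Space X]

theorem mem_regularProb_iff (Λ : WeakDual ℝ C(X, ℝ)) :
    Λ ∈ regularProb X ↔ (∀ f : C(X, ℝ), 0 ≤ f → 0 ≤ Λ f) ∧ Λ 1 = 1 := by
  let : MeasurableSpace X := borel X
  have : BorelSpace X := ⟨rfl⟩
  constructor
  · rintro ⟨μ, hr, hp, h⟩
    refine ⟨fun f hf => ?_, ?_⟩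
    · rw [h]
      exact integral_nonneg fun x => hf x
    · rw [h]
      simp
  · rintro ⟨hpos, hone⟩
    let T : CompactlySupportedContinuousMap X ℝ →ₚ[ℝ] ℝ :=
      PositiveLinearMap.mk₀
        { toFun := fun f => Λ f.toContinuousMap
          map_add' := fun f g => by
            rw [← map_add]; rfl
          map_smul' := fun c f => by
            rw [RingHom.id_apply, ← map_smul]; rfl }
        (fun f hf => hpos _ fun x => hf x)
    have key : ∀ f : C(X, ℝ), Λ f = ∫ x, f x ∂(RealRMK.rieszMeasure T) := by
      intro f
      have h := RealRMK.integral_rieszMeasure T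
        (CompactlySupportedContinuousMap.continuousMapEquiv f)
      exact h.symm
    refine ⟨RealRMK.rieszMeasure T, inferInstance, ?_, key⟩
    have h1 := key 1
    rw [hone] at h1
    simp only [ContinuousMap.one_apply, integral_const, smul_eq_mul, mul_one] at h1
    have : IsFiniteMeasure (RealRMK.rieszMeasure T) :=
      ⟨isCompact_univ.measure_lt_top⟩
    refine ⟨?_⟩
    rw [measureReal_def] at h1
    rw [← ENNReal.ofReal_toReal (measure_ne_top (RealRMK.rieszMeasure T) univ), ← h1]
    simp

theorem abs_le_norm_of_mem_regularProb {Λ : WeakDual ℝ C(X, ℝ)} (h : Λ ∈ regularProb X)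
    (f : C(X, ℝ)) : |Λ f| ≤ ‖f‖ := by
  rw [mem_regularProb_iff] at h
  have h1 : 0 ≤ Λ (‖f‖ • (1 : C(X, ℝ)) - f) := h.1 _ fun x => by
    have := (abs_le.1 (f.norm_coe_le_norm x)).2
    simpa using this
  have h2 : 0 ≤ Λ (‖f‖ • (1 : C(X, ℝ)) + f) := h.1 _ fun x => by
    have := (abs_le.1 (f.norm_coe_le_norm x)).1
    simp
    linarith
  rw [map_sub, map_smul, h.2, smul_eq_mul] at h1
  rw [map_add, map_smul, h.2, smul_eq_mul] at h2
  rw [abs_le]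
  constructor <;> linarith

theorem isCompact_regularProb : IsCompact (regularProb X) := by
  have hc : IsClosed (regularProb X) := by
    have : regularProb X = (⋂ f : C(X, ℝ), ⋂ _ : 0 ≤ f, {Λ : WeakDual ℝ C(X, ℝ) | 0 ≤ Λ f}) ∩
        {Λ : WeakDual ℝ C(X, ℝ) | Λ 1 = 1} := by
      ext Λ
      rw [mem_regularProb_iff]
      simp
    rw [this]
    refine IsClosed.inter ?_ (isClosed_eq (WeakDual.eval_continuous _) continuous_const)
    exact isClosed_iInter fun f => isClosed_iInter fun _ =>
      isClosed_le continuous_const (WeakDual.eval_continuous f)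
  refine (WeakDual.isCompact_closedBall (𝕜 := ℝ) (E := C(X, ℝ)) 0 1).of_isClosed_subset hc ?_
  intro Λ hΛ
  simp only [mem_preimage, Metric.mem_closedBall, dist_zero_right]
  refine ContinuousLinearMap.opNorm_le_bound _ zero_le_one fun f => ?_
  rw [one_mul]
  exact abs_le_norm_of_mem_regularProb hΛ f

theorem convex_regularProb : Convex ℝ (regularProb X) := by
  intro Λ hΛ Θ hΘ a b ha hb hab
  rw [mem_regularProb_iff] at *
  have e : ∀ f, (a • Λ + b • Θ) f = a * Λ f + b * Θ f := fun f => rfl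
  refine ⟨fun f hf => ?_, ?_⟩
  · rw [e]
    exact add_nonneg (mul_nonneg ha (hΛ.1 f hf)) (mul_nonneg hb (hΘ.1 f hf))
  · rw [e, hΛ.2, hΘ.2]
    linarith

end regularProb

section action

variable {G : Type u} [Group G] [TopologicalSpace G] (X : GFlow G)

/-- The continuous map `x ↦ g • x`. -/
def smulMap (g : G) : C(X, X) := ⟨fun x => g • x, continuous_const_smul g⟩

/-- Push-forward of functionals along `x ↦ g • x`: `(g • Λ) f = Λ (f (g • ·))`. If `Λ` is
integration against `μ`, this is integration against the image of `μ` under `x ↦ g • x`. -/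
noncomputable def pushFunctional (g : G) (Λ : WeakDual ℝ C(X, ℝ)) : WeakDual ℝ C(X, ℝ) :=
  StrongDual.toWeakDual
    { toFun := fun f => Λ (f.comp (smulMap X g))
      map_add' := fun f h => by rw [ContinuousMap.add_comp, map_add]
      map_smul' := fun c f => by rw [ContinuousMap.smul_comp, map_smul, RingHom.id_apply]
      cont := (WeakDual.toStrongDual Λ).continuous.comp
        (ContinuousMap.continuous_precomp (smulMap X g)) }

theorem pushFunctional_apply (g : G) (Λ : WeakDual ℝ C(X, ℝ)) (f : C(X, ℝ)) :
    pushFunctional X g Λ f = Λ (f.comp (smulMap X g)) := rfl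

theorem pushFunctional_mem (g : G) {Λ : WeakDual ℝ C(X, ℝ)} (h : Λ ∈ regularProb X) :
    pushFunctional X g Λ ∈ regularProb X := by
  rw [mem_regularProb_iff] at *
  exact ⟨fun f hf => h.1 _ fun x => hf (g • x), h.2⟩

noncomputable instance regularProbAction : MulAction G (regularProb X) where
  smul g Λ := ⟨pushFunctional X g Λ.1, pushFunctional_mem X g Λ.2⟩
  one_smul Λ := by
    refine Subtype.ext (DFunLike.ext _ _ fun f => ?_)
    change Λ.1 (f.comp (smulMap X 1)) = Λ.1 f
    congr 1
    ext x
    exact congrArg f (one_smul G x)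
  mul_smul g h Λ := by
    refine Subtype.ext (DFunLike.ext _ _ fun f => ?_)
    change Λ.1 (f.comp (smulMap X (g * h))) = Λ.1 ((f.comp (smulMap X g)).comp (smulMap X h))
    congr 1
    ext x
    exact congrArg f (mul_smul g h x)

theorem regularProb_smul_apply (g : G) (Λ : regularProb X) (f : C(X, ℝ)) :
    (g • Λ).1 f = Λ.1 (f.comp (smulMap X g)) := rfl

instance regularProb_continuousSMul : ContinuousSMul G (regularProb X) where
  continuous_smul := by
    refine Continuous.subtype_mk (WeakDual.continuous_of_continuous_eval fun f => ?_) _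
    change Continuous fun p : G × regularProb X => p.2.1 (f.comp (smulMap X p.1))
    have hF : Continuous fun g : G => f.comp (smulMap X g) :=
      ContinuousMap.continuous_of_continuous_uncurry _
        (f.continuous.comp (continuous_smul (M := G) (X := X)))
    rw [continuous_iff_continuousAt]
    rintro ⟨g₀, Λ₀⟩
    have h1 : Filter.Tendsto (fun p : G × regularProb X => p.2.1 (f.comp (smulMap X g₀)))
        (𝓝 (g₀, Λ₀)) (𝓝 (Λ₀.1 (f.comp (smulMap X g₀)))) :=
      ((WeakDual.eval_continuous _).comp (continuous_subtype_val.comp continuous_snd)).tendsto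
        (g₀, Λ₀)
    have h2 : Filter.Tendsto
        (fun p : G × regularProb X => ‖f.comp (smulMap X p.1) - f.comp (smulMap X g₀)‖)
        (𝓝 (g₀, Λ₀)) (𝓝 0) := by
      have := (((hF.comp continuous_fst).sub continuous_const).norm :
        Continuous fun p : G × regularProb X =>
          ‖f.comp (smulMap X p.1) - f.comp (smulMap X g₀)‖).tendsto (g₀, Λ₀)
      simpa using this
    have h3 : Filter.Tendsto
        (fun p : G × regularProb X => p.2.1 (f.comp (smulMap X p.1) - f.comp (smulMap X g₀)))
        (𝓝 (g₀, Λ₀)) (𝓝 0) :=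
      squeeze_zero_norm (fun p => abs_le_norm_of_mem_regularProb p.2.2 _) h2
    have h4 := h3.add h1
    rw [zero_add] at h4
    refine h4.congr fun p => ?_
    rw [map_sub, sub_add_cancel]

/-- The affine `G`-flow `P(X)` of regular Borel probability measures on the `G`-flow `X`, with the
weak-* topology and the action by push-forward. -/
noncomputable def probFlow : AffineFlow G where
  E := WeakDual ℝ C(X, ℝ)
  locallyConvex := inferInstanceAs (LocallyConvexSpace ℝ (WeakBilin (topDualPairing ℝ C(X, ℝ))))
  carrier := regularProb X
  isCompact := isCompact_regularProb
  convex := convex_regularProb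
  affine g Λ Θ Ξ a b _ _ _ h := by
    refine DFunLike.ext _ _ fun f => ?_
    change Ξ.1 (f.comp (smulMap X g)) =
      a * Λ.1 (f.comp (smulMap X g)) + b * Θ.1 (f.comp (smulMap X g))
    rw [h]
    rfl

end action

/-!
Proximal irreducibility makes morphisms rigid: if `a` and `b` map an irreducible flow to the closure
of the extreme points of `K` and agree over `L`, then the orbit closures of the midpoints of `a` and
`b` generate an affine subflow which has to be all of `K`; an extreme point of `K` is a midpoint
only when `a = b` there. Given two extensions `K` and `K'` of `L`, an irreducible subflow `W` of the
fibred product of the closures of their extreme points maps to both, and the barycenter map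
`P(W) → K` is proximally irreducible. Uniqueness follows: if both extensions are maximal, then `K`
and `K'` are isomorphic to `P(W)`, compatibly with the maps to `L`.

For existence, composing with the barycenter maps `P(W) → K` shows that the extensions of `L` of the
form `P(X)` are directed. Each such `X` is a quotient of one fixed Stone-Čech compactification, so a
set of them is cofinal, and by rigidity the irreducible subflows of their product over `L` give
an upper bound. This is a greatest extension, hence maximal, again by rigidity.

If the orbit of an extreme point of `L` is dense in the closure of the extreme points, then limits
of translates along ultrafilters on `G`, which are affine although not continuous, move a point of
a subflow that lies over this orbit to every other fiber, and composition follows.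
-/

section Convexity

variable {E : Type*} [AddCommGroup E] [Module ℝ E]

theorem mem_convexHull_inter_of_isExtreme {s A B : Set E} (hB : IsExtreme ℝ s B)
    (hs : Convex ℝ s) (hA : A ⊆ s) {x : E} (hx : x ∈ convexHull ℝ A) (hxB : x ∈ B) :
    x ∈ convexHull ℝ (A ∩ B) := by
  have hconvex : Convex ℝ {v | v ∈ s ∧ (v ∈ B → v ∈ convexHull ℝ (A ∩ B))} := by
    rw [convex_iff_openSegment_subset]
    rintro v ⟨hv, hv'⟩ w ⟨hw, hw'⟩ z hz
    refine ⟨hs.openSegment_subset hv hw hz, fun hzB => ?_⟩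
    exact (convex_convexHull ℝ _).openSegment_subset
      (hv' (hB.left_mem_of_mem_openSegment hv hw hzB hz))
      (hw' (hB.right_mem_of_mem_openSegment hv hw hzB hz)) hz
  have hsubset : A ⊆ {v | v ∈ s ∧ (v ∈ B → v ∈ convexHull ℝ (A ∩ B))} := fun v hv =>
    ⟨hA hv, fun hvB => subset_convexHull ℝ _ ⟨hv, hvB⟩⟩
  exact (convexHull_min hsubset hconvex hx).2 hxB

variable [TopologicalSpace E] [IsTopologicalAddGroup E] [ContinuousSMul ℝ E]

theorem isCompact_convexJoin {s t : Set E} (hs : IsCompact s) (ht : IsCompact t) :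
    IsCompact (convexJoin ℝ s t) := by
  have himage : convexJoin ℝ s t =
      (fun p : (E × E) × ℝ => (1 - p.2) • p.1.1 + p.2 • p.1.2) '' ((s ×ˢ t) ×ˢ Icc (0 : ℝ) 1) := by
    ext z
    simp only [mem_convexJoin, segment_eq_image, mem_image, mem_prod]
    constructor
    · rintro ⟨x, hx, y, hy, θ, hθ, rfl⟩
      exact ⟨((x, y), θ), ⟨⟨hx, hy⟩, hθ⟩, rfl⟩
    · rintro ⟨⟨⟨x, y⟩, θ⟩, ⟨⟨hx, hy⟩, hθ⟩, rfl⟩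
      exact ⟨x, hx, y, hy, θ, hθ, rfl⟩
  rw [himage]
  exact ((hs.prod ht).prod isCompact_Icc).image (by fun_prop)

theorem isCompact_convexHull_biUnion {ι : Type*} (F : Finset ι) (S : ι → Set E)
    (hS : ∀ i ∈ F, IsCompact (S i)) (hS' : ∀ i ∈ F, Convex ℝ (S i)) :
    IsCompact (convexHull ℝ (⋃ i ∈ F, S i)) := by
  classical
  induction F using Finset.induction_on with
  | empty => simp
  | insert a F _ ih =>
    rw [Finset.forall_mem_insert] at hS hS'
    have hF := ih hS.2 hS'.2
    rw [Finset.set_biUnion_insert]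
    rcases (S a).eq_empty_or_nonempty with hSa | hSa
    · rwa [hSa, empty_union]
    rcases (⋃ i ∈ F, S i).eq_empty_or_nonempty with hSF | hSF
    · rw [hSF, union_empty, hS'.1.convexHull_eq]
      exact hS.1
    · rw [convexHull_union hSa hSF, hS'.1.convexHull_eq]
      exact isCompact_convexJoin hS.1 hF

theorem exists_sub_mem_of_mem_extremePoints [T2Space E] {T V : Set E} (hT : IsCompact T)
    (hK : IsCompact (closure (convexHull ℝ T))) (hV : V ∈ 𝓝 0) (hVconvex : Convex ℝ V)
    (hVclosed : IsClosed V) {x : E} (hx : x ∈ (closure (convexHull ℝ T)).extremePoints ℝ) :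
    ∃ t ∈ T, x - t ∈ V := by
  obtain ⟨F, hFT, hF⟩ := hT.elim_nhds_subcover (fun t => (fun y => y - t) ⁻¹' V) fun t _ =>
    (continuous_sub_right t).continuousAt.preimage_mem_nhds (by rwa [sub_self])
  let S : E → Set E := fun t => closure (convexHull ℝ T) ∩ (fun y => y - t) ⁻¹' V
  have hS : ∀ t, IsCompact (S t) := fun t =>
    hK.inter_right (hVclosed.preimage (continuous_sub_right t))
  have hS' : ∀ t, Convex ℝ (S t) := fun t =>
    (convex_convexHull ℝ T).closure.inter
      (by simpa only [sub_eq_add_neg] using hVconvex.translate_preimage_left (-t))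
  have hcover : closure (convexHull ℝ T) = convexHull ℝ (⋃ t ∈ F, S t) := by
    apply Subset.antisymm
    · refine closure_minimal (convexHull_mono fun y hy => ?_)
        (isCompact_convexHull_biUnion F S (fun t _ => hS t) fun t _ => hS' t).isClosed
      obtain ⟨t, ht, hyt⟩ := mem_iUnion₂.1 (hF hy)
      exact mem_iUnion₂.2 ⟨t, ht, subset_closure (subset_convexHull ℝ T hy), hyt⟩
    · exact convexHull_min (iUnion₂_subset fun t _ => inter_subset_left)
        (convex_convexHull ℝ T).closure
  rw [hcover] at hx
  obtain ⟨t, ht, hxt⟩ := mem_iUnion₂.1 (extremePoints_convexHull_subset hx)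
  exact ⟨t, hFT t ht, hxt.2⟩

/-- **Milman's theorem**, the partial converse of the Krein–Milman theorem. -/
theorem extremePoints_closure_convexHull_subset [LocallyConvexSpace ℝ E] [T2Space E] {T : Set E}
    (hT : IsCompact T) (hK : IsCompact (closure (convexHull ℝ T))) :
    (closure (convexHull ℝ T)).extremePoints ℝ ⊆ T := by
  intro x hx
  rw [← hT.isClosed.closure_eq, mem_closure_iff_nhds]
  intro U hU
  have hU₀ : (fun v => x - v) ⁻¹' U ∈ 𝓝 (0 : E) :=
    (continuous_sub_left x).continuousAt.preimage_mem_nhds (by rwa [sub_zero])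
  obtain ⟨V, ⟨hV, hVconvex⟩, hVU⟩ :=
    (LocallyConvexSpace.convex_basis_zero ℝ E).nhds_closure.mem_iff.1 hU₀
  obtain ⟨t, ht, hxt⟩ := exists_sub_mem_of_mem_extremePoints hT hK
    (Filter.mem_of_superset hV subset_closure) hVconvex.closure isClosed_closure hx
  exact ⟨t, by simpa only [mem_preimage, sub_sub_cancel] using hVU hxt, ht⟩

theorem continuous_of_forall_strongDual [LocallyConvexSpace ℝ E] [T2Space E] {s : Set E}
    (hs : IsCompact s) {Y : Type*} [TopologicalSpace Y] {f : Y → s}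
    (hf : ∀ l : StrongDual ℝ E, Continuous fun y => l (f y)) : Continuous f := by
  have : CompactSpace s := isCompact_iff_compactSpace.1 hs
  have hembedding : IsClosedEmbedding fun (x : s) (l : StrongDual ℝ E) => l x := by
    refine Continuous.isClosedEmbedding (by fun_prop) fun x y hxy => ?_
    by_contra hne
    obtain ⟨l, hl⟩ := geometric_hahn_banach_point_point fun h => hne (Subtype.ext h)
    exact hl.ne (congrFun hxy l)
  exact hembedding.continuous_iff.2 (continuous_pi hf)

theorem mem_of_closure_convexHull_eq [LocallyConvexSpace ℝ E] [T2Space E] {s : Set E}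
    (hs : IsCompact s) {T : Set s} (hT : IsClosed T)
    (hTs : closure (convexHull ℝ (Subtype.val '' T)) = s) {x : s}
    (hx : (x : E) ∈ s.extremePoints ℝ) : x ∈ T := by
  have : CompactSpace s := isCompact_iff_compactSpace.1 hs
  have hMilman := extremePoints_closure_convexHull_subset
    (hT.isCompact.image continuous_subtype_val) (hTs.symm ▸ hs)
  rw [hTs] at hMilman
  exact Subtype.val_injective.mem_set_image.1 (hMilman hx)

theorem eq_univ_of_extremePoints_subset [LocallyConvexSpace ℝ E] [T2Space E] {s : Set E}
    (hs : IsCompact s) (hs' : Convex ℝ s) {D : Set s} (hD : IsClosed D)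
    (hD' : Convex ℝ (Subtype.val '' D)) (hext : ∀ x : s, (x : E) ∈ s.extremePoints ℝ → x ∈ D) :
    D = univ := by
  have : CompactSpace s := isCompact_iff_compactSpace.1 hs
  refine eq_univ_of_forall fun x => Subtype.val_injective.mem_set_image.1 ?_
  refine closure_minimal (convexHull_min (fun y hy => ?_) hD')
    (hD.isCompact.image continuous_subtype_val).isClosed
    ((closure_convexHull_extremePoints hs hs').symm.subset x.2)
  exact ⟨⟨y, hy.1⟩, hext _ hy, rfl⟩

end Convexity

namespace PreservesConvexComb

variable {E F : Type u} [AddCommGroup E] [Module ℝ E] [AddCommGroup F] [Module ℝ F]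
  {s : Set E} {t : Set F} {f : s → t}

theorem comp {H : Type u} [AddCommGroup H] [Module ℝ H] {r : Set H} {g : t → r}
    (hg : PreservesConvexComb g) (hf : PreservesConvexComb f) : PreservesConvexComb (g ∘ f) :=
  fun x y z a b ha hb hab h => hg _ _ _ a b ha hb hab (hf x y z a b ha hb hab h)

theorem convex_range (hf : PreservesConvexComb f) (hs : Convex ℝ s) :
    Convex ℝ (Subtype.val '' range f) := by
  rintro _ ⟨_, ⟨x, rfl⟩, rfl⟩ _ ⟨_, ⟨y, rfl⟩, rfl⟩ a b ha hb hab
  exact ⟨_, ⟨⟨_, hs x.2 y.2 ha hb hab⟩, rfl⟩, hf x y _ a b ha hb hab rfl⟩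

theorem convex_preimage (hf : PreservesConvexComb f) (hs : Convex ℝ s) {D : Set F}
    (hD : Convex ℝ D) : Convex ℝ (Subtype.val '' {x | (f x : F) ∈ D}) := by
  rintro _ ⟨x, hx, rfl⟩ _ ⟨y, hy, rfl⟩ a b ha hb hab
  refine ⟨⟨_, hs x.2 y.2 ha hb hab⟩, ?_, rfl⟩
  rw [mem_ofPred_eq, hf x y _ a b ha hb hab rfl]
  exact hD hx hy ha hb hab

theorem convex_equalizer {g : s → t} (hf : PreservesConvexComb f) (hg : PreservesConvexComb g)
    (hs : Convex ℝ s) : Convex ℝ (Subtype.val '' {x | f x = g x}) := by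
  rintro _ ⟨x, hx, rfl⟩ _ ⟨y, hy, rfl⟩ a b ha hb hab
  refine ⟨⟨_, hs x.2 y.2 ha hb hab⟩, Subtype.ext ?_, rfl⟩
  rw [hf x y _ a b ha hb hab rfl, hg x y _ a b ha hb hab rfl, show f x = g x from hx,
    show f y = g y from hy]

theorem isExtreme_preimage (hf : PreservesConvexComb f) {y : t}
    (hy : (y : F) ∈ t.extremePoints ℝ) : IsExtreme ℝ s (Subtype.val '' (f ⁻¹' {y})) := by
  refine ⟨Subtype.coe_image_subset _ _, ?_⟩
  rintro x₁ h₁ x₂ h₂ _ ⟨x, hx, rfl⟩ ⟨a, b, ha, hb, hab, hxab⟩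
  refine ⟨⟨x₁, h₁⟩, Subtype.ext (hy.2 (f ⟨x₁, h₁⟩).2 (f ⟨x₂, h₂⟩).2 ⟨a, b, ha, hb, hab, ?_⟩), rfl⟩
  rw [← hf ⟨x₁, h₁⟩ ⟨x₂, h₂⟩ x a b ha.le hb.le hab hxab.symm, show f x = y from hx]

theorem mem_convexHull_fiber (hf : PreservesConvexComb f) (hs : Convex ℝ s) {A : Set s} {x : s}
    (hx : (x : E) ∈ convexHull ℝ (Subtype.val '' A)) (hfx : (f x : F) ∈ t.extremePoints ℝ) :
    (x : E) ∈ convexHull ℝ (Subtype.val '' {z ∈ A | f z = f x}) := by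
  have hmem := mem_convexHull_inter_of_isExtreme (hf.isExtreme_preimage hfx) hs
    (Subtype.coe_image_subset _ A) hx ⟨x, rfl, rfl⟩
  rwa [← image_inter Subtype.val_injective] at hmem

theorem convex_fiber (hf : PreservesConvexComb f) (hs : Convex ℝ s) (y : t) :
    Convex ℝ (Subtype.val '' (f ⁻¹' {y})) := by
  have h := hf.convex_preimage hs (convex_singleton (𝕜 := ℝ) (y : F))
  simp only [mem_singleton_iff, ← Subtype.ext_iff] at h
  exact h

end PreservesConvexComb

/-- A continuous affine map between subsets of topological vector spaces. -/
structure IsContinuousAffine {E F : Type u} [AddCommGroup E] [Module ℝ E] [TopologicalSpace E]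
    [AddCommGroup F] [Module ℝ F] [TopologicalSpace F] {s : Set E} {t : Set F} (f : s → t) :
    Prop where
  continuous : Continuous f
  affine : PreservesConvexComb f

namespace IsContinuousAffine

variable {E F : Type u} [AddCommGroup E] [Module ℝ E] [TopologicalSpace E]
  [AddCommGroup F] [Module ℝ F] [TopologicalSpace F] {s : Set E} {t : Set F} {f : s → t}

theorem comp {H : Type u} [AddCommGroup H] [Module ℝ H] [TopologicalSpace H] {r : Set H}
    {g : t → r} (hg : IsContinuousAffine g) (hf : IsContinuousAffine f) :
    IsContinuousAffine (g ∘ f) :=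
  ⟨hg.continuous.comp hf.continuous, hg.affine.comp hf.affine⟩

theorem prodMk {H : Type u} [AddCommGroup H] [Module ℝ H] [TopologicalSpace H] {r : Set H}
    {g : s → r} (hf : IsContinuousAffine f) (hg : IsContinuousAffine g) :
    IsContinuousAffine (t := t ×ˢ r) fun x => ⟨(f x, g x), (f x).2, (g x).2⟩ where
  continuous := by
    have := hf.continuous
    have := hg.continuous
    fun_prop
  affine x y z a b ha hb hab h :=
    Prod.ext (hf.affine x y z a b ha hb hab h) (hg.affine x y z a b ha hb hab h)

theorem piMk {ι : Type u} {H : ι → Type u} [∀ i, AddCommGroup (H i)] [∀ i, Module ℝ (H i)]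
    [∀ i, TopologicalSpace (H i)] {r : ∀ i, Set (H i)} {g : ∀ i, s → r i}
    (hg : ∀ i, IsContinuousAffine (g i)) :
    IsContinuousAffine (t := univ.pi r) fun x => ⟨fun i => g i x, fun i _ => (g i x).2⟩ where
  continuous := by
    have := fun i => (hg i).continuous
    fun_prop
  affine x y z a b ha hb hab h := funext fun i => (hg i).affine x y z a b ha hb hab h

variable [T2Space F]

theorem exists_extremePoint [IsTopologicalAddGroup E] [ContinuousSMul ℝ E]
    [LocallyConvexSpace ℝ E] [T2Space E] (hf : IsContinuousAffine f) (hs : IsCompact s) {y : t}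
    (hy : (y : F) ∈ t.extremePoints ℝ) (hyf : y ∈ range f) :
    ∃ x : s, (x : E) ∈ s.extremePoints ℝ ∧ f x = y := by
  obtain ⟨x, rfl⟩ := hyf
  have : CompactSpace s := isCompact_iff_compactSpace.1 hs
  have hfiber : IsCompact (Subtype.val '' (f ⁻¹' {f x})) :=
    (isClosed_singleton.preimage hf.continuous).isCompact.image continuous_subtype_val
  obtain ⟨_, hz⟩ := hfiber.extremePoints_nonempty ⟨x, x, rfl, rfl⟩
  obtain ⟨z, hzx, rfl⟩ := hz.1
  exact ⟨z, (hf.affine.isExtreme_preimage hy).extremePoints_subset_extremePoints hz, hzx⟩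

end IsContinuousAffine

section Flow

variable {G : Type*} {X Y Z : Type*} [TopologicalSpace X] [TopologicalSpace Y] [TopologicalSpace Z]

/-- A morphism of `G`-flows: a continuous equivariant map. -/
structure IsFlowMap (G : Type*) {X Y : Type*} [TopologicalSpace X] [TopologicalSpace Y] [SMul G X]
    [SMul G Y] (f : X → Y) : Prop where
  continuous : Continuous f
  map_smul : ∀ (g : G) (x : X), f (g • x) = g • f x

/-- A subflow of a `G`-flow: a closed invariant subset, possibly empty. -/
structure IsSubflow (G : Type*) {X : Type*} [TopologicalSpace X] [SMul G X] (T : Set X) :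
    Prop where
  isClosed : IsClosed T
  smul_mem : ∀ (g : G) (x : X), x ∈ T → g • x ∈ T

/-- A map `π : W → Y` is irreducible over `S ⊆ Y` if `W` is the only subflow of `W` whose image
contains `S`. -/
structure IsIrreducibleOver (G : Type*) {W Y : Type*} [TopologicalSpace W] [SMul G W] (π : W → Y)
    (S : Set Y) : Prop where
  subset_range : S ⊆ range π
  eq_univ : ∀ T : Set W, IsSubflow G T → S ⊆ π '' T → T = univ

section SMul

variable [SMul G X] [SMul G Y] [SMul G Z]

theorem IsFlowMap.comp {f : Y → Z} {h : X → Y} (hf : IsFlowMap G f) (hh : IsFlowMap G h) :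
    IsFlowMap G (f ∘ h) where
  continuous := hf.continuous.comp hh.continuous
  map_smul g x := by simp only [Function.comp_apply, hh.map_smul, hf.map_smul]

theorem IsFlowMap.fst : IsFlowMap G (Prod.fst : X × Y → X) := ⟨continuous_fst, fun _ _ => rfl⟩

theorem IsFlowMap.snd : IsFlowMap G (Prod.snd : X × Y → Y) := ⟨continuous_snd, fun _ _ => rfl⟩

namespace IsSubflow

theorem inter {S T : Set X} (hS : IsSubflow G S) (hT : IsSubflow G T) : IsSubflow G (S ∩ T) :=
  ⟨hS.isClosed.inter hT.isClosed, fun g x hx => ⟨hS.smul_mem g x hx.1, hT.smul_mem g x hx.2⟩⟩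

theorem iInter {ι : Sort*} {T : ι → Set X} (hT : ∀ i, IsSubflow G (T i)) :
    IsSubflow G (⋂ i, T i) :=
  ⟨isClosed_iInter fun i => (hT i).isClosed, fun g x hx =>
    mem_iInter.2 fun i => (hT i).smul_mem g x (mem_iInter.1 hx i)⟩

theorem preimage {T : Set Y} (hT : IsSubflow G T) {f : X → Y} (hf : IsFlowMap G f) :
    IsSubflow G (f ⁻¹' T) :=
  ⟨hT.isClosed.preimage hf.continuous, fun g x hx => by
    rw [mem_preimage, hf.map_smul]
    exact hT.smul_mem g _ hx⟩

theorem image [CompactSpace X] [T2Space Y] {T : Set X} (hT : IsSubflow G T) {f : X → Y}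
    (hf : IsFlowMap G f) : IsSubflow G (f '' T) where
  isClosed := (hT.isClosed.isCompact.image hf.continuous).isClosed
  smul_mem := by
    rintro g _ ⟨x, hx, rfl⟩
    exact ⟨g • x, hT.smul_mem g x hx, hf.map_smul g x⟩

end IsSubflow

theorem IsFlowMap.isSubflow_range [CompactSpace X] [T2Space Y] {f : X → Y} (hf : IsFlowMap G f) :
    IsSubflow G (range f) := by
  rw [← image_univ]
  exact IsSubflow.image ⟨isClosed_univ, fun _ _ _ => mem_univ _⟩ hf

theorem IsFlowMap.isSubflow_equalizer [T2Space Y] {f h : X → Y} (hf : IsFlowMap G f)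
    (hh : IsFlowMap G h) : IsSubflow G {x | f x = h x} :=
  ⟨isClosed_eq hf.continuous hh.continuous, fun g x hx => by
    rw [mem_ofPred_eq, hf.map_smul, hh.map_smul, show f x = h x from hx]⟩

end SMul

theorem isSubflow_closure_orbit [Group G] [MulAction G X] [ContinuousConstSMul G X] (x : X) :
    IsSubflow G (closure (MulAction.orbit G x)) :=
  ⟨isClosed_closure, fun g _ hy =>
    (MulAction.mapsTo_smul_orbit g x).closure (continuous_const_smul g) hy⟩

theorem exists_minimal_isSubflow [SMul G X] [CompactSpace X] [T1Space Y] {π : X → Y}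
    (hπ : Continuous π) {S : Set Y} {T : Set X} (hT : IsSubflow G T) (hST : S ⊆ π '' T) :
    ∃ M ⊆ T, Minimal (fun M => IsSubflow G M ∧ S ⊆ π '' M) M := by
  refine zorn_superset_nonempty {M | IsSubflow G M ∧ S ⊆ π '' M} (fun c hc hchain hne => ?_) T
    ⟨hT, hST⟩
  have : Nonempty c := hne.to_subtype
  refine ⟨⋂₀ c, ⟨?_, fun y hy => ?_⟩, fun M hM => sInter_subset_of_mem hM⟩
  · rw [sInter_eq_iInter]
    exact IsSubflow.iInter fun M => (hc M.2).1
  have hclosed : ∀ M : c, IsClosed ((M : Set X) ∩ π ⁻¹' {y}) := fun M =>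
    (hc M.2).1.isClosed.inter (isClosed_singleton.preimage hπ)
  have hdirected : Directed (· ⊇ ·) fun M : c => (M : Set X) ∩ π ⁻¹' {y} := fun A B =>
    (hchain.total A.2 B.2).elim (fun h => ⟨A, Subset.rfl, inter_subset_inter_left _ h⟩)
      fun h => ⟨B, inter_subset_inter_left _ h, Subset.rfl⟩
  obtain ⟨x, hx⟩ := IsCompact.nonempty_iInter_of_directed_nonempty_isCompact_isClosed
    (fun M : c => (M : Set X) ∩ π ⁻¹' {y}) hdirected (fun M => (hc M.2).2 hy)
    (fun M => (hclosed M).isCompact) hclosed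
  rw [mem_iInter] at hx
  exact ⟨x, fun M hM => (hx ⟨M, hM⟩).1, (hx (Classical.arbitrary c)).2⟩

end Flow

section OfSubflow

variable {G : Type u} [Group G] [TopologicalSpace G] {X : Type u} [TopologicalSpace X]
  [CompactSpace X] [T2Space X] [MulAction G X]

/-- A subflow as a `G`-invariant subset. -/
def IsSubflow.toSubMulAction {G X : Type*} [TopologicalSpace X] [SMul G X] {T : Set X}
    (hT : IsSubflow G T) : SubMulAction G X where
  carrier := T
  smul_mem' g {x} := hT.smul_mem g x

instance {T : Set X} (hT : IsSubflow G T) : CompactSpace hT.toSubMulAction :=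
  isCompact_iff_compactSpace.1 hT.isClosed.isCompact

/-- A subflow as a `G`-flow in its own right. -/
abbrev GFlow.ofSubflow [ContinuousSMul G X] {T : Set X} (hT : IsSubflow G T) : GFlow G where
  carrier := hT.toSubMulAction

theorem isFlowMap_val_ofSubflow [ContinuousSMul G X] {T : Set X} (hT : IsSubflow G T) :
    IsFlowMap G (fun x : GFlow.ofSubflow hT => (x : X)) :=
  ⟨continuous_subtype_val, fun _ _ => rfl⟩

theorem exists_isIrreducibleOver [ContinuousSMul G X] {Y : Type*} [TopologicalSpace Y] [T1Space Y]
    {π : X → Y} (hπ : Continuous π) {S : Set Y} {T : Set X} (hT : IsSubflow G T)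
    (hST : S ⊆ π '' T) :
    ∃ (W : GFlow G) (i : W → X), IsFlowMap G i ∧ Function.Injective i ∧ (∀ w, i w ∈ T) ∧
      IsIrreducibleOver G (π ∘ i) S := by
  obtain ⟨M, hMT, ⟨hM, hSM⟩, hmin⟩ := exists_minimal_isSubflow hπ hT hST
  have hval := isFlowMap_val_ofSubflow hM
  refine ⟨GFlow.ofSubflow hM, _, hval, Subtype.val_injective, fun w => hMT w.2, ?_, ?_⟩
  · intro y hy
    obtain ⟨x, hx, rfl⟩ := hSM hy
    exact ⟨⟨x, hx⟩, rfl⟩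
  · intro D hD hSD
    have hMD := hmin ⟨hD.image hval, by rwa [← image_comp]⟩
      (by rintro _ ⟨w, -, rfl⟩; exact w.2)
    exact eq_univ_of_forall fun w => Subtype.val_injective.mem_set_image.1 (hMD w.2)

end OfSubflow

namespace AffineFlow

variable {G : Type u} [Group G] [TopologicalSpace G] {K L P : AffineFlow G}

instance (K : AffineFlow G) : CompactSpace K := isCompact_iff_compactSpace.1 K.isCompact

/-- `K.extClosure` as a set of points of `K`. -/
def extSet (K : AffineFlow G) : Set K := {x | (x : K.E) ∈ K.extClosure}

/-- The (not closed) convex hull of the points of `K.extClosure` that `φ` maps to `y`, as a set of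
points of `K`: these are the sets that the subflows in the definition of proximal irreducibility
have to meet. -/
def fiberHull (φ : K → L) (y : L) : Set K :=
  {x | (x : K.E) ∈ convexHull ℝ (Subtype.val '' {z | z ∈ K.extSet ∧ φ z = y})}

theorem mem_extSet_of_mem_extremePoints {x : K} (hx : (x : K.E) ∈ K.carrier.extremePoints ℝ) :
    x ∈ K.extSet :=
  subset_closure hx

theorem extSet_nonempty [h : Nonempty K] : K.extSet.Nonempty := by
  obtain ⟨x, hx⟩ := K.isCompact.extremePoints_nonempty (nonempty_coe_sort.1 h)
  exact ⟨⟨x, hx.1⟩, mem_extSet_of_mem_extremePoints hx⟩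

theorem extSet_subset {D : Set K} (hD : IsClosed D)
    (hext : ∀ x : K, (x : K.E) ∈ K.carrier.extremePoints ℝ → x ∈ D) : K.extSet ⊆ D := by
  have hsubset : K.extClosure ⊆ Subtype.val '' D :=
    closure_minimal (fun x hx => ⟨⟨x, hx.1⟩, hext _ hx, rfl⟩)
      (hD.isCompact.image continuous_subtype_val).isClosed
  exact fun x hx => Subtype.val_injective.mem_set_image.1 (hsubset hx)

theorem smul_mem_extremePoints (g : G) {x : K} (hx : (x : K.E) ∈ K.carrier.extremePoints ℝ) :
    ((g • x : K) : K.E) ∈ K.carrier.extremePoints ℝ := by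
  have hextreme := (K.affine g⁻¹).isExtreme_preimage hx
  have hpreimage : (fun z : K => g⁻¹ • z) ⁻¹' {x} = {g • x} := by
    ext z
    exact inv_smul_eq_iff
  rwa [hpreimage, image_singleton, isExtreme_singleton] at hextreme

theorem isSubflow_extSet (K : AffineFlow G) : IsSubflow G K.extSet where
  isClosed := isClosed_closure.preimage continuous_subtype_val
  smul_mem g _ hx :=
    extSet_subset (D := (fun z => g • z) ⁻¹' K.extSet)
      ((isClosed_closure.preimage continuous_subtype_val).preimage (continuous_const_smul g))
      (fun _ hz => mem_extSet_of_mem_extremePoints (smul_mem_extremePoints g hz)) hx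

/-- The closure of the set of extreme points, as a flow. -/
abbrev extFlow (K : AffineFlow G) : GFlow G := GFlow.ofSubflow K.isSubflow_extSet

theorem isFlowMap_val_extFlow (K : AffineFlow G) : IsFlowMap G (fun x : K.extFlow => (x : K)) :=
  isFlowMap_val_ofSubflow K.isSubflow_extSet

section fiberHull

variable {φ : K → L} {y : L}

theorem mem_fiberHull_of_mem_extSet {x : K} (hx : x ∈ K.extSet) : x ∈ fiberHull φ (φ x) :=
  subset_convexHull ℝ _ (mem_image_of_mem _ ⟨hx, rfl⟩)

theorem convex_fiberHull : Convex ℝ (Subtype.val '' fiberHull φ y) := by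
  rw [fiberHull, ← preimage_ofPred_eq, Subtype.image_preimage_coe]
  exact K.convex.inter (convex_convexHull ℝ _)

theorem fiberHull_subset {D : Set K} (hD : Convex ℝ (Subtype.val '' D))
    (h : ∀ x ∈ K.extSet, φ x = y → x ∈ D) : fiberHull φ y ⊆ D := fun _ hx =>
  Subtype.val_injective.mem_set_image.1
    (convexHull_min (image_mono fun z hz => h z hz.1 hz.2) hD hx)

theorem mapsTo_fiberHull {K' L' : AffineFlow G} {ψ : K' → L'} {y' : L'} {α : K → K'}
    (hα : PreservesConvexComb α) (hext : MapsTo α K.extSet K'.extSet)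
    (hy : ∀ x ∈ K.extSet, φ x = y → ψ (α x) = y') :
    MapsTo α (fiberHull φ y) (fiberHull ψ y') :=
  fiberHull_subset (hα.convex_preimage K.convex (convex_convexHull ℝ _)) fun x hx hxy =>
    hy x hx hxy ▸ mem_fiberHull_of_mem_extSet (hext hx)

end fiberHull

theorem IsAffineSubflow.isSubflow {C : Set K.E} (hC : K.IsAffineSubflow C) :
    IsSubflow G (Subtype.val ⁻¹' C : Set K) :=
  ⟨hC.isCompact.isClosed.preimage continuous_subtype_val, hC.smul_mem⟩

theorem IsAffineSubflow.eq_carrier {C : Set K.E} (hC : K.IsAffineSubflow C)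
    (hext : ∀ x : K, (x : K.E) ∈ K.carrier.extremePoints ℝ → (x : K.E) ∈ C) : C = K.carrier := by
  have hconvex : Convex ℝ (Subtype.val '' (Subtype.val ⁻¹' C : Set K)) := by
    rw [Subtype.image_preimage_coe]
    exact K.convex.inter hC.convex
  have huniv := eq_univ_of_extremePoints_subset K.isCompact K.convex hC.isSubflow.isClosed
    hconvex hext
  exact hC.subset.antisymm fun x hx => eq_univ_iff_forall.1 huniv ⟨x, hx⟩

theorem isAffineSubflow_closure_convexHull {T : Set K} (hne : T.Nonempty)
    (hT : ∀ (g : G) (x : K), x ∈ T → g • x ∈ T) :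
    K.IsAffineSubflow (closure (convexHull ℝ (Subtype.val '' T))) := by
  set C := closure (convexHull ℝ (Subtype.val '' T))
  have hTC : Subtype.val '' T ⊆ C := (subset_convexHull ℝ _).trans subset_closure
  have hsubset : C ⊆ K.carrier :=
    closure_minimal (convexHull_min (Subtype.coe_image_subset _ _) K.convex) K.isCompact.isClosed
  have hconvex : Convex ℝ C := (convex_convexHull ℝ _).closure
  refine ⟨hsubset, (hne.image _).mono hTC, K.isCompact.of_isClosed_subset isClosed_closure hsubset,
    hconvex, fun g x hx => ?_⟩
  have hpreimage : C ⊆ Subtype.val '' {x : K | ((g • x : K) : K.E) ∈ C} := by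
    refine closure_minimal (convexHull_min (image_mono fun z hz => ?_)
      ((K.affine g).convex_preimage K.convex hconvex)) ?_
    · exact hTC (mem_image_of_mem _ (hT g z hz))
    · exact ((isClosed_closure.preimage (continuous_subtype_val.comp
        (continuous_const_smul g))).isCompact.image continuous_subtype_val).isClosed
  exact Subtype.val_injective.mem_set_image.1 (hpreimage hx)

namespace IsAffineExtension

variable {φ : K → L}

theorem isContinuousAffine (hφ : IsAffineExtension φ) : IsContinuousAffine φ :=
  ⟨hφ.continuous, hφ.affine⟩

theorem isFlowMap (hφ : IsAffineExtension φ) : IsFlowMap G φ := ⟨hφ.continuous, hφ.map_smul⟩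

theorem comp {ψ : P → K} (hφ : IsAffineExtension φ) (hψ : IsAffineExtension ψ) :
    IsAffineExtension (φ ∘ ψ) where
  continuous := hφ.continuous.comp hψ.continuous
  map_smul := (hφ.isFlowMap.comp hψ.isFlowMap).map_smul
  affine := hφ.affine.comp hψ.affine
  surjective := hφ.surjective.comp hψ.surjective

theorem exists_mem_extSet (hφ : IsAffineExtension φ) {y : L} (hy : y ∈ L.extSet) :
    ∃ x ∈ K.extSet, φ x = y := by
  refine extSet_subset (D := φ '' K.extSet)
    (K.isSubflow_extSet.image hφ.isFlowMap).isClosed (fun z hz => ?_) hy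
  obtain ⟨x, hx, hxz⟩ := hφ.isContinuousAffine.exists_extremePoint K.isCompact hz (hφ.surjective z)
  exact ⟨x, mem_extSet_of_mem_extremePoints hx, hxz⟩

theorem isProxIrrExtension (hφ : IsAffineExtension φ)
    (h : ∀ C, K.IsAffineSubflow C → (∀ y ∈ L.extSet, ∃ x ∈ fiberHull φ y, (x : K.E) ∈ C) →
      ∀ x ∈ K.extSet, (x : K.E) ∈ C) : IsProxIrrExtension φ where
  toIsAffineExtension := hφ
  eq_of_meets C hC hmeets :=
    hC.eq_carrier fun x hx => h C hC (fun y hy => by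
      obtain ⟨z, hzC, hz⟩ := hmeets y hy
      exact ⟨⟨z, hC.subset hzC⟩, hz, hzC⟩) x (mem_extSet_of_mem_extremePoints hx)

end IsAffineExtension

namespace IsProxIrrExtension

variable {φ : K → L}

theorem extSet_subset_of_meets (hφ : IsProxIrrExtension φ) {T : Set K} (hT : IsSubflow G T)
    (hmeets : ∀ y ∈ L.extSet, ∃ x ∈ fiberHull φ y, x ∈ T) : K.extSet ⊆ T := by
  refine extSet_subset hT.isClosed fun x hx => ?_
  have hne : T.Nonempty := by
    have : Nonempty L := ⟨φ x⟩
    obtain ⟨y, hy⟩ := extSet_nonempty (K := L)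
    obtain ⟨z, -, hz⟩ := hmeets y hy
    exact ⟨z, hz⟩
  refine mem_of_closure_convexHull_eq K.isCompact hT.isClosed ?_ hx
  refine hφ.eq_of_meets _ (isAffineSubflow_closure_convexHull hne hT.smul_mem) fun y hy => ?_
  obtain ⟨z, hz, hzT⟩ := hmeets y hy
  exact ⟨z, subset_closure (subset_convexHull ℝ _ (mem_image_of_mem _ hzT)), hz⟩

theorem extSet_subset_of_surjOn (hφ : IsProxIrrExtension φ) {T : Set K} (hT : IsSubflow G T)
    (hsurj : SurjOn φ (K.extSet ∩ T) L.extSet) : K.extSet ⊆ T :=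
  hφ.extSet_subset_of_meets hT fun y hy => by
    obtain ⟨x, ⟨hx, hxT⟩, rfl⟩ := hsurj hy
    exact ⟨x, mem_fiberHull_of_mem_extSet hx, hxT⟩

theorem mapsTo_extSet (hφ : IsProxIrrExtension φ) : MapsTo φ K.extSet L.extSet :=
  hφ.extSet_subset_of_surjOn (L.isSubflow_extSet.preimage hφ.isFlowMap) fun y hy => by
    obtain ⟨x, hx, rfl⟩ := hφ.exists_mem_extSet hy
    exact ⟨x, ⟨hx, hy⟩, rfl⟩

end IsProxIrrExtension

end AffineFlow

section ProbFlow

variable {G : Type u} [Group G] [TopologicalSpace G] {X : GFlow G}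

/-- Integration against an element of `P(X)`, as a continuous linear functional. -/
noncomputable def probEval (Λ : probFlow X) : StrongDual ℝ C(X, ℝ) := WeakDual.toStrongDual Λ.1

theorem probEval_injective : Function.Injective (probEval (X := X)) := fun _ _ h =>
  Subtype.ext (WeakDual.toStrongDual.injective h)

theorem continuous_probEval (f : C(X, ℝ)) : Continuous fun Λ : probFlow X => probEval Λ f :=
  (WeakDual.eval_continuous f).comp continuous_subtype_val

theorem probEval_of_eq_convexComb {Λ Θ Ξ : probFlow X} {a b : ℝ}
    (h : (Ξ : (probFlow X).E) = a • (Λ : (probFlow X).E) + b • (Θ : (probFlow X).E))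
    (f : C(X, ℝ)) : probEval Ξ f = a * probEval Λ f + b * probEval Θ f :=
  DFunLike.congr_fun (F := WeakDual ℝ C(X, ℝ)) h f

theorem probEval_nonneg (Λ : probFlow X) {f : C(X, ℝ)} (hf : 0 ≤ f) : 0 ≤ probEval Λ f :=
  ((mem_regularProb_iff _).1 Λ.2).1 f hf

theorem probEval_mono (Λ : probFlow X) {f g : C(X, ℝ)} (h : f ≤ g) :
    probEval Λ f ≤ probEval Λ g := by
  have := probEval_nonneg Λ (sub_nonneg.2 h)
  rwa [map_sub, sub_nonneg] at this

theorem probEval_const (Λ : probFlow X) (c : ℝ) : probEval Λ (ContinuousMap.const X c) = c := by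
  have hone : probEval Λ 1 = 1 := ((mem_regularProb_iff _).1 Λ.2).2
  have hsmul : ContinuousMap.const X c = c • (1 : C(X, ℝ)) := by
    ext
    simp
  rw [hsmul, map_smul, hone, smul_eq_mul, mul_one]

/-- The Dirac measure at a point. -/
noncomputable def diracProb (X : GFlow G) (x : X) : probFlow X :=
  ⟨StrongDual.toWeakDual (ContinuousMap.evalCLM ℝ x),
    (mem_regularProb_iff _).2 ⟨fun _ hf => hf x, rfl⟩⟩

theorem probEval_diracProb (x : X) (f : C(X, ℝ)) : probEval (diracProb X x) f = f x := rfl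

theorem isFlowMap_diracProb : IsFlowMap G (diracProb X) where
  continuous :=
    Continuous.subtype_mk (WeakDual.continuous_of_continuous_eval fun f => f.continuous) _
  map_smul _ _ := rfl

theorem diracProb_injective : Function.Injective (diracProb X) := by
  intro x y h
  by_contra hxy
  obtain ⟨f, hfx, hfy, -⟩ := exists_continuous_zero_one_of_isClosed (isClosed_singleton (x := x))
    (isClosed_singleton (x := y)) (disjoint_singleton.2 hxy)
  have hf : f x = f y := congrArg (fun Λ => probEval Λ f) h
  rw [hfx rfl, hfy rfl] at hf
  exact zero_ne_one hf

theorem eq_diracProb_of_probEval_eq_zero {Λ : probFlow X} {x : X}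
    (h : ∀ f : C(X, ℝ), 0 ≤ f → f x = 0 → probEval Λ f = 0) : Λ = diracProb X x := by
  refine probEval_injective (ContinuousLinearMap.ext fun f => ?_)
  set c := ContinuousMap.const X (f x)
  have hzero : probEval Λ |f - c| = 0 := h _ (abs_nonneg _) (by simp [c])
  have hupper := probEval_mono Λ (le_abs_self (f - c))
  have hlower := probEval_mono Λ (neg_le_abs (f - c))
  rw [map_sub, probEval_const] at hupper
  rw [map_neg, map_sub, probEval_const] at hlower
  rw [probEval_diracProb]
  linarith

theorem diracProb_mem_extremePoints (x : X) :
    (diracProb X x : (probFlow X).E) ∈ (probFlow X).carrier.extremePoints ℝ := by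
  refine ⟨(diracProb X x).2, ?_⟩
  rintro Λ hΛ Θ hΘ ⟨a, b, ha, hb, -, h⟩
  lift Λ to probFlow X using hΛ
  lift Θ to probFlow X using hΘ
  refine congrArg Subtype.val (eq_diracProb_of_probEval_eq_zero fun f hf hfx => ?_)
  have hsum := probEval_of_eq_convexComb h.symm f
  rw [probEval_diracProb, hfx] at hsum
  nlinarith [mul_nonneg ha.le (probEval_nonneg Λ hf), mul_nonneg hb.le (probEval_nonneg Θ hf)]

theorem closure_convexHull_range_diracProb :
    closure (convexHull ℝ (Subtype.val '' range (diracProb X))) = (probFlow X).carrier := by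
  apply Subset.antisymm
  · exact closure_minimal (convexHull_min (Subtype.coe_image_subset _ _) (probFlow X).convex)
      (probFlow X).isCompact.isClosed
  intro Λ hΛ
  by_contra hmem
  obtain ⟨l, r, hl, hr⟩ :=
    geometric_hahn_banach_closed_point (convex_convexHull ℝ _).closure isClosed_closure hmem
  obtain ⟨f, hf⟩ := LinearMap.dualEmbedding_surjective (topDualPairing ℝ C(X, ℝ)) l
  have heval : ∀ Θ : probFlow X, l Θ.1 = probEval Θ f := fun Θ => by
    rw [← hf]
    rfl
  have hfr : f ≤ ContinuousMap.const X r := fun x => by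
    have hx := hl _ (subset_closure (subset_convexHull ℝ _ ⟨_, ⟨x, rfl⟩, rfl⟩))
    rw [heval] at hx
    exact hx.le
  have hle := probEval_mono ⟨Λ, hΛ⟩ hfr
  rw [probEval_const, ← heval] at hle
  exact hle.not_gt hr

theorem mem_extremePoints_probFlow {Λ : probFlow X} :
    (Λ : (probFlow X).E) ∈ (probFlow X).carrier.extremePoints ℝ ↔ Λ ∈ range (diracProb X) := by
  refine ⟨fun h => mem_of_closure_convexHull_eq (probFlow X).isCompact
    isFlowMap_diracProb.isSubflow_range.isClosed closure_convexHull_range_diracProb h, ?_⟩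
  rintro ⟨x, rfl⟩
  exact diracProb_mem_extremePoints x

theorem extSet_probFlow : (probFlow X).extSet = range (diracProb X) := by
  refine (AffineFlow.extSet_subset isFlowMap_diracProb.isSubflow_range.isClosed
    fun _ h => mem_extremePoints_probFlow.1 h).antisymm fun Λ hΛ => ?_
  exact AffineFlow.mem_extSet_of_mem_extremePoints (mem_extremePoints_probFlow.2 hΛ)

theorem eq_univ_of_diracProb_mem {D : Set (probFlow X)} (hD : IsClosed D)
    (hD' : Convex ℝ (Subtype.val '' D)) (hdirac : ∀ x, diracProb X x ∈ D) : D = univ :=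
  eq_univ_of_extremePoints_subset (probFlow X).isCompact (probFlow X).convex hD hD' fun Λ hΛ => by
    obtain ⟨x, rfl⟩ := mem_extremePoints_probFlow.1 hΛ
    exact hdirac x

section

variable {F : Type u} [AddCommGroup F] [Module ℝ F] [TopologicalSpace F] [T2Space F] {t : Set F}
  {f h : probFlow X → t}

theorem IsContinuousAffine.eq_of_comp_diracProb_eq (hf : IsContinuousAffine f)
    (hh : IsContinuousAffine h) (heq : f ∘ diracProb X = h ∘ diracProb X) : f = h :=
  funext <| eq_univ_iff_forall.1 <| eq_univ_of_diracProb_mem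
    (isClosed_eq hf.continuous hh.continuous)
    (hf.affine.convex_equalizer hh.affine (probFlow X).convex) (congrFun heq)

theorem IsContinuousAffine.exists_eq_diracProb (hf : IsContinuousAffine f)
    (hinj : Function.Injective (f ∘ diracProb X)) {Λ : probFlow X}
    (hΛ : (f Λ : F) ∈ t.extremePoints ℝ) : ∃ x, Λ = diracProb X x := by
  set B : Set (probFlow X).E := Subtype.val '' (f ⁻¹' {f Λ})
  have hBcompact : IsCompact B :=
    (isClosed_singleton.preimage hf.continuous).isCompact.image continuous_subtype_val
  have hBext : ∀ Θ ∈ B.extremePoints ℝ,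
      ∃ x, f (diracProb X x) = f Λ ∧ (diracProb X x : (probFlow X).E) = Θ := by
    intro Θ hΘ
    obtain ⟨Θ, hΘΛ, rfl⟩ := hΘ.1
    obtain ⟨x, rfl⟩ := mem_extremePoints_probFlow.1
      ((hf.affine.isExtreme_preimage hΛ).extremePoints_subset_extremePoints hΘ)
    exact ⟨x, hΘΛ, rfl⟩
  obtain ⟨Θ, hΘ⟩ := hBcompact.extremePoints_nonempty ⟨_, Λ, rfl, rfl⟩
  obtain ⟨x, hx, rfl⟩ := hBext Θ hΘ
  have hBsingleton : B.extremePoints ℝ = {(diracProb X x : (probFlow X).E)} := by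
    refine eq_singleton_iff_unique_mem.2 ⟨hΘ, fun Ξ hΞ => ?_⟩
    obtain ⟨y, hy, rfl⟩ := hBext Ξ hΞ
    rw [hinj (hy.trans hx.symm)]
  have hKM := closure_convexHull_extremePoints hBcompact
    (hf.affine.convex_fiber (probFlow X).convex (f Λ))
  rw [hBsingleton, convexHull_singleton, closure_singleton] at hKM
  exact ⟨x, Subtype.ext (hKM.symm.subset ⟨Λ, rfl, rfl⟩)⟩

end

section Barycenter

variable {K : AffineFlow G} {f : X → K}

/-- Composition of a continuous linear functional with a map into an affine flow. -/
def functionalComp (hf : Continuous f) (l : StrongDual ℝ K.E) : C(X, ℝ) :=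
  ⟨fun x => l (f x), l.continuous.comp (continuous_subtype_val.comp hf)⟩

theorem exists_barycenter (hf : Continuous f) (Λ : probFlow X) :
    ∃ k : K, ∀ l : StrongDual ℝ K.E, l k = probEval Λ (functionalComp hf l) := by
  let J : K → StrongDual ℝ K.E → ℝ := fun k l => l k
  let I : probFlow X → StrongDual ℝ K.E → ℝ := fun Λ l => probEval Λ (functionalComp hf l)
  have hJ : Continuous J := by fun_prop
  have hI : Continuous I := continuous_pi fun l => continuous_probEval _
  suffices hrange : I ⁻¹' range J = univ by
    obtain ⟨k, hk⟩ := eq_univ_iff_forall.1 hrange Λ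
    exact ⟨k, congrFun hk⟩
  refine eq_univ_of_diracProb_mem ((isCompact_range hJ).isClosed.preimage hI) ?_
    fun x => ⟨f x, rfl⟩
  rintro _ ⟨Λ, ⟨k, hk⟩, rfl⟩ _ ⟨Θ, ⟨m, hm⟩, rfl⟩ a b ha hb hab
  refine ⟨⟨_, (probFlow X).convex Λ.2 Θ.2 ha hb hab⟩,
    ⟨⟨_, K.convex k.2 m.2 ha hb hab⟩, funext fun l => ?_⟩, rfl⟩
  have hcomb := probEval_of_eq_convexComb (Λ := Λ) (Θ := Θ)
    (Ξ := ⟨_, (probFlow X).convex Λ.2 Θ.2 ha hb hab⟩) rfl (functionalComp hf l)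
  have hkl : l k = probEval Λ (functionalComp hf l) := congrFun hk l
  have hml : l m = probEval Θ (functionalComp hf l) := congrFun hm l
  simp only [J, I, map_add, map_smul, smul_eq_mul, hcomb, hkl, hml]

/-- The barycenter map `P(X) → K` of `f : X → K`, the integral of `f` against a measure. It is the
continuous affine extension of `f` from the Dirac measures to `P(X)`. -/
noncomputable def barycenter (hf : Continuous f) (Λ : probFlow X) : K :=
  (exists_barycenter hf Λ).choose

theorem strongDual_barycenter (hf : Continuous f) (Λ : probFlow X) (l : StrongDual ℝ K.E) :
    l (barycenter hf Λ) = probEval Λ (functionalComp hf l) :=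
  (exists_barycenter hf Λ).choose_spec l

theorem eq_barycenter (hf : Continuous f) {Λ : probFlow X} {k : K}
    (hk : ∀ l : StrongDual ℝ K.E, l k = probEval Λ (functionalComp hf l)) :
    k = barycenter hf Λ := by
  by_contra hne
  obtain ⟨l, hl⟩ := geometric_hahn_banach_point_point fun h => hne (Subtype.ext h)
  rw [hk, strongDual_barycenter] at hl
  exact lt_irrefl _ hl

theorem barycenter_diracProb (hf : Continuous f) (x : X) : barycenter hf (diracProb X x) = f x :=
  (eq_barycenter hf fun _ => rfl).symm

theorem isContinuousAffine_barycenter (hf : Continuous f) :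
    IsContinuousAffine (barycenter hf) where
  continuous := continuous_of_forall_strongDual K.isCompact fun l => by
    simpa only [strongDual_barycenter] using continuous_probEval (functionalComp hf l)
  affine Λ Θ Ξ a b ha hb hab h :=
    congrArg Subtype.val (eq_barycenter hf (Λ := Ξ)
      (k := ⟨_, K.convex (barycenter hf Λ).2 (barycenter hf Θ).2 ha hb hab⟩) fun l => by
        rw [probEval_of_eq_convexComb h, ← strongDual_barycenter, ← strongDual_barycenter,
          map_add, map_smul, map_smul, smul_eq_mul, smul_eq_mul]).symm

theorem isFlowMap_barycenter (hf : IsFlowMap G f) : IsFlowMap G (barycenter hf.continuous) where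
  continuous := (isContinuousAffine_barycenter hf.continuous).continuous
  map_smul g := by
    have hb := isContinuousAffine_barycenter hf.continuous
    refine congrFun (IsContinuousAffine.eq_of_comp_diracProb_eq
      (hb.comp ⟨continuous_const_smul g, (probFlow X).affine g⟩)
      (IsContinuousAffine.comp ⟨continuous_const_smul g, K.affine g⟩ hb) (funext fun x => ?_))
    simp only [Function.comp_apply, ← isFlowMap_diracProb.map_smul, barycenter_diracProb,
      hf.map_smul]

theorem isAffineExtension_barycenter (hf : IsFlowMap G f) (hext : K.extSet ⊆ range f) :
    AffineFlow.IsAffineExtension (barycenter hf.continuous) where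
  continuous := (isContinuousAffine_barycenter hf.continuous).continuous
  map_smul := (isFlowMap_barycenter hf).map_smul
  affine := (isContinuousAffine_barycenter hf.continuous).affine
  surjective := by
    have hb := isContinuousAffine_barycenter hf.continuous
    refine range_eq_univ.1 (eq_univ_of_extremePoints_subset K.isCompact K.convex
      (isCompact_range hb.continuous).isClosed (hb.affine.convex_range (probFlow X).convex)
      fun k hk => ?_)
    obtain ⟨x, rfl⟩ := hext (AffineFlow.mem_extSet_of_mem_extremePoints hk)
    exact ⟨diracProb X x, barycenter_diracProb _ x⟩

end Barycenter

end ProbFlow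

section ProbMap

variable {G : Type u} [Group G] [TopologicalSpace G] {X W Z : GFlow G} {K L : AffineFlow G}

theorem IsContinuousAffine.comp_barycenter {φ : K → L} (hφ : IsContinuousAffine φ) {f : X → K}
    (hf : Continuous f) : φ ∘ barycenter hf = barycenter (hφ.continuous.comp hf) :=
  (hφ.comp (isContinuousAffine_barycenter hf)).eq_of_comp_diracProb_eq
    (isContinuousAffine_barycenter _) <| funext fun x => by
      simp only [Function.comp_apply, barycenter_diracProb]

/-- Push-forward of measures along a continuous map. -/
noncomputable def probMap {p : W → X} (hp : Continuous p) : probFlow W → probFlow X :=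
  barycenter (isFlowMap_diracProb.continuous.comp hp)

theorem probMap_diracProb {p : W → X} (hp : Continuous p) (w : W) :
    probMap hp (diracProb W w) = diracProb X (p w) :=
  barycenter_diracProb _ w

theorem isContinuousAffine_probMap {p : W → X} (hp : Continuous p) :
    IsContinuousAffine (probMap hp) :=
  isContinuousAffine_barycenter _

theorem probMap_comp_probMap {s : X → Z} {p : W → X} (hs : Continuous s) (hp : Continuous p) :
    probMap hs ∘ probMap hp = probMap (hs.comp hp) :=
  ((isContinuousAffine_probMap hs).comp (isContinuousAffine_probMap hp)).eq_of_comp_diracProb_eq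
    (isContinuousAffine_probMap _) <| funext fun w => by
      simp only [Function.comp_apply, probMap_diracProb]

theorem isFlowMap_probMap {p : W → X} (hp : IsFlowMap G p) : IsFlowMap G (probMap hp.continuous) :=
  isFlowMap_barycenter (isFlowMap_diracProb.comp hp)

namespace AffineFlow

theorem fiberHull_probFlow_subset {φ : probFlow X → L} {y : L} {D : Set (probFlow X)}
    (hD : Convex ℝ (Subtype.val '' D)) (h : ∀ x, φ (diracProb X x) = y → diracProb X x ∈ D) :
    fiberHull φ y ⊆ D :=
  fiberHull_subset hD fun Λ hΛ => by
    rw [extSet_probFlow] at hΛ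
    obtain ⟨x, rfl⟩ := hΛ
    exact h x

theorem mapsTo_fiberHull_probFlow {φ : probFlow X → L} {y : L} {P : AffineFlow G} {ψ : K → P}
    {z : P} {α : probFlow X → K} (hα : PreservesConvexComb α)
    (h : ∀ x, φ (diracProb X x) = y → α (diracProb X x) ∈ K.extSet ∧ ψ (α (diracProb X x)) = z) :
    MapsTo α (fiberHull φ y) (fiberHull ψ z) :=
  fiberHull_probFlow_subset (hα.convex_preimage (probFlow X).convex (convex_convexHull ℝ _))
    fun x hx => subset_convexHull ℝ _ (mem_image_of_mem _ (h x hx))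

theorem isProxIrrExtension_barycenter_extFlow (K : AffineFlow G) :
    IsProxIrrExtension (barycenter K.isFlowMap_val_extFlow.continuous) := by
  refine (isAffineExtension_barycenter K.isFlowMap_val_extFlow
    fun k hk => ⟨⟨k, hk⟩, rfl⟩).isProxIrrExtension fun C _ hmeets Λ hΛ => ?_
  rw [extSet_probFlow] at hΛ
  obtain ⟨x, rfl⟩ := hΛ
  obtain ⟨Θ, hΘ, hΘC⟩ := hmeets x x.2
  have hsingle : Θ ∈ ({diracProb K.extFlow x} : Set (probFlow K.extFlow)) := by
    refine fiberHull_probFlow_subset ?_ (fun z hz => ?_) hΘ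
    · rw [image_singleton]
      exact convex_singleton _
    · rw [barycenter_diracProb] at hz
      rw [Subtype.ext hz]
      rfl
  rwa [← mem_singleton_iff.1 hsingle]

end AffineFlow

end ProbMap

namespace AffineFlow

variable {G : Type u} [Group G] [TopologicalSpace G] {K K' L : AffineFlow G}

theorem IsProxIrrExtension.extSet_subset_range {φ : K → L} (hφ : IsProxIrrExtension φ)
    {W : GFlow G} {f : W → K} (hf : IsFlowMap G f) (hfext : ∀ w, f w ∈ K.extSet)
    (hsurj : L.extSet ⊆ range (φ ∘ f)) : K.extSet ⊆ range f :=
  hφ.extSet_subset_of_surjOn hf.isSubflow_range fun y hy => by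
    obtain ⟨w, rfl⟩ := hsurj hy
    exact ⟨f w, ⟨hfext w, w, rfl⟩, rfl⟩

/-- A joining of two extensions `φ` and `ψ` of `L`: a flow of pairs of points of the closures of
the sets of extreme points that lie over the same point of `L`, irreducible over the closure of the
set of extreme points of `L`. -/
structure IsJoining (φ : K → L) (ψ : K' → L) {W : GFlow G} (p : W → K.extFlow)
    (q : W → K'.extFlow) : Prop where
  isFlowMap_left : IsFlowMap G p
  isFlowMap_right : IsFlowMap G q
  comm : ∀ w, φ (p w) = ψ (q w)
  injective : Function.Injective fun w => (p w, q w)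
  isIrreducibleOver : IsIrreducibleOver G (fun w => φ (p w)) L.extSet

theorem exists_isJoining {φ : K → L} {ψ : K' → L} (hφ : IsAffineExtension φ)
    (hψ : IsAffineExtension ψ) :
    ∃ (W : GFlow G) (p : W → K.extFlow) (q : W → K'.extFlow), IsJoining φ ψ p q := by
  have hfst : IsFlowMap G fun v : K.extFlow × K'.extFlow => φ v.1 :=
    hφ.isFlowMap.comp (K.isFlowMap_val_extFlow.comp IsFlowMap.fst)
  have hsnd : IsFlowMap G fun v : K.extFlow × K'.extFlow => ψ v.2 :=
    hψ.isFlowMap.comp (K'.isFlowMap_val_extFlow.comp IsFlowMap.snd)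
  obtain ⟨W, i, hi, hinj, hiT, hirr⟩ := exists_isIrreducibleOver hfst.continuous
    (hfst.isSubflow_equalizer hsnd) (S := L.extSet) fun y hy => by
      obtain ⟨x, hx, rfl⟩ := hφ.exists_mem_extSet hy
      obtain ⟨z, hz, hzx⟩ := hψ.exists_mem_extSet hy
      exact ⟨(⟨x, hx⟩, ⟨z, hz⟩), hzx.symm, rfl⟩
  exact ⟨W, fun w => (i w).1, fun w => (i w).2, IsFlowMap.fst.comp hi, IsFlowMap.snd.comp hi, hiT,
    hinj, hirr⟩

namespace IsJoining

variable {φ : K → L} {ψ : K' → L} {W : GFlow G} {p : W → K.extFlow} {q : W → K'.extFlow}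

theorem symm (h : IsJoining φ ψ p q) : IsJoining ψ φ q p where
  isFlowMap_left := h.isFlowMap_right
  isFlowMap_right := h.isFlowMap_left
  comm w := (h.comm w).symm
  injective := Prod.swap_injective.comp h.injective
  isIrreducibleOver := by simpa only [h.comm] using h.isIrreducibleOver

theorem isFlowMap_val_left (h : IsJoining φ ψ p q) : IsFlowMap G fun w => (p w : K) :=
  K.isFlowMap_val_extFlow.comp h.isFlowMap_left

theorem exists_eq_diracProb (h : IsJoining φ ψ p q) {Λ : probFlow W}
    (hleft : probMap h.isFlowMap_left.continuous Λ ∈ range (diracProb K.extFlow))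
    (hright : (barycenter h.symm.isFlowMap_val_left.continuous Λ : K'.E) ∈
      K'.carrier.extremePoints ℝ) :
    ∃ w, Λ = diracProb W w := by
  refine ((isContinuousAffine_probMap h.isFlowMap_left.continuous).prodMk
    (isContinuousAffine_barycenter h.symm.isFlowMap_val_left.continuous)).exists_eq_diracProb
    (fun w w' hww' => ?_) ?_
  · obtain ⟨hp, hq⟩ := Prod.ext_iff.1 (congrArg Subtype.val hww')
    simp only [Function.comp_apply, probMap_diracProb, barycenter_diracProb] at hp hq
    exact h.injective (Prod.ext (diracProb_injective (Subtype.ext hp))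
      (Subtype.ext (Subtype.ext hq)))
  · rw [extremePoints_prod]
    exact ⟨mem_extremePoints_probFlow.2 hleft, hright⟩

/-- Proximal irreducibility of `ψ` is applied to the set of all such barycenters. -/
theorem extSet_subset_image_barycenter (h : IsJoining φ ψ p q) (hφ : IsAffineExtension φ)
    (hψ : IsProxIrrExtension ψ) {C : Set (probFlow W).E} (hC : (probFlow W).IsAffineSubflow C)
    (hmeets : ∀ x ∈ K.extSet, ∃ Λ ∈ fiberHull (barycenter h.isFlowMap_val_left.continuous) x,
      (Λ : (probFlow W).E) ∈ C) :
    K'.extSet ⊆ barycenter h.symm.isFlowMap_val_left.continuous '' ((Subtype.val ⁻¹' C) ∩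
      probMap h.isFlowMap_left.continuous ⁻¹' range (diracProb K.extFlow)) := by
  refine hψ.extSet_subset_of_meets ((hC.isSubflow.inter
    (isFlowMap_diracProb.isSubflow_range.preimage (isFlowMap_probMap h.isFlowMap_left))).image
    (isFlowMap_barycenter h.symm.isFlowMap_val_left)) fun y hy => ?_
  obtain ⟨x, hx, rfl⟩ := hφ.exists_mem_extSet hy
  obtain ⟨Λ, hΛ, hΛC⟩ := hmeets x hx
  refine ⟨_, mapsTo_fiberHull_probFlow (isContinuousAffine_barycenter _).affine (fun w hw => ?_) hΛ,
    Λ, ⟨hΛC, ⟨x, hx⟩, ?_⟩, rfl⟩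
  · rw [barycenter_diracProb] at hw ⊢
    exact ⟨(q w).2, by rw [← h.comm, hw]⟩
  · have hfiber := fiberHull_probFlow_subset
      ((isContinuousAffine_probMap h.isFlowMap_left.continuous).affine.convex_fiber
        (probFlow W).convex (diracProb K.extFlow ⟨x, hx⟩)) (fun w hw => ?_) hΛ
    · exact (mem_singleton_iff.1 hfiber).symm
    · rw [barycenter_diracProb] at hw
      rw [mem_preimage, probMap_diracProb]
      exact congrArg (diracProb _) (Subtype.ext hw)

theorem isProxIrrExtension_barycenter (h : IsJoining φ ψ p q) (hφ : IsProxIrrExtension φ)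
    (hψ : IsProxIrrExtension ψ) :
    IsProxIrrExtension (barycenter h.isFlowMap_val_left.continuous) := by
  refine (isAffineExtension_barycenter h.isFlowMap_val_left (hφ.extSet_subset_range
    h.isFlowMap_val_left (fun w => (p w).2) h.isIrreducibleOver.subset_range)).isProxIrrExtension
    fun C hC hmeets => ?_
  have hT : IsSubflow G (diracProb W ⁻¹' (Subtype.val ⁻¹' C)) :=
    hC.isSubflow.preimage isFlowMap_diracProb
  have himage : K'.extSet ⊆ (fun w => (q w : K')) '' (diracProb W ⁻¹' (Subtype.val ⁻¹' C)) := by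
    refine extSet_subset (hT.image h.symm.isFlowMap_val_left).isClosed fun z hz => ?_
    obtain ⟨Λ, ⟨hΛC, hΛ⟩, rfl⟩ := h.extSet_subset_image_barycenter hφ.toIsAffineExtension hψ hC
      hmeets (mem_extSet_of_mem_extremePoints hz)
    obtain ⟨w, rfl⟩ := h.exists_eq_diracProb hΛ hz
    exact ⟨w, hΛC, (barycenter_diracProb h.symm.isFlowMap_val_left.continuous w).symm⟩
  have huniv := h.isIrreducibleOver.eq_univ _ hT fun y hy => by
    obtain ⟨z, hz, rfl⟩ := hψ.exists_mem_extSet hy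
    obtain ⟨w, hw, rfl⟩ := himage hz
    exact ⟨w, hw, h.comm w⟩
  rw [extSet_probFlow]
  rintro _ ⟨w, rfl⟩
  exact eq_univ_iff_forall.1 huniv w

theorem comp_barycenter_eq (h : IsJoining φ ψ p q) (hφ : IsContinuousAffine φ)
    (hψ : IsContinuousAffine ψ) :
    φ ∘ barycenter h.isFlowMap_val_left.continuous =
      ψ ∘ barycenter h.symm.isFlowMap_val_left.continuous := by
  rw [hφ.comp_barycenter, hψ.comp_barycenter]
  congr 1
  exact funext h.comm

end IsJoining

end AffineFlow

section Lift

variable {G : Type u} [Group G] [TopologicalSpace G] {W X : GFlow G}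

theorem IsFlowMap.exists_lift_diracProb {f : W → probFlow X} (hf : IsFlowMap G f)
    (hrange : ∀ w, f w ∈ range (diracProb X)) :
    ∃ a : W → X, IsFlowMap G a ∧ diracProb X ∘ a = f := by
  choose a ha using hrange
  have hcomp : diracProb X ∘ a = f := funext ha
  refine ⟨a, ⟨?_, fun g w => diracProb_injective ?_⟩, hcomp⟩
  · rw [(isFlowMap_diracProb.continuous.isClosedEmbedding diracProb_injective).continuous_iff,
      hcomp]
    exact hf.continuous
  · rw [isFlowMap_diracProb.map_smul, ha, ha, hf.map_smul]

end Lift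

namespace AffineFlow

variable {G : Type u} [Group G] [TopologicalSpace G] {K L P : AffineFlow G}

section Rigidity

variable {W : GFlow G} {a b : W → K}

/-- The pointwise midpoint of two maps into an affine flow. -/
noncomputable def midpointMap (a b : W → K) (w : W) : K :=
  ⟨(2⁻¹ : ℝ) • (a w : K.E) + (2⁻¹ : ℝ) • (b w : K.E),
    K.convex (a w).2 (b w).2 (by norm_num) (by norm_num) (by norm_num)⟩

theorem isFlowMap_midpointMap (ha : IsFlowMap G a) (hb : IsFlowMap G b) :
    IsFlowMap G (midpointMap a b) where
  continuous := Continuous.subtype_mk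
    (((continuous_subtype_val.comp ha.continuous).const_smul _).add
      ((continuous_subtype_val.comp hb.continuous).const_smul _)) _
  map_smul g w := Subtype.ext <| by
    have := K.affine g (a w) (b w) (midpointMap a b w) 2⁻¹ 2⁻¹ (by norm_num) (by norm_num)
      (by norm_num) rfl
    simp only [← ha.map_smul, ← hb.map_smul] at this
    exact this.symm

theorem midpointMap_mem {D : Set K} (hD : Convex ℝ (Subtype.val '' D)) {w : W} (ha : a w ∈ D)
    (hb : b w ∈ D) : midpointMap a b w ∈ D :=
  Subtype.val_injective.mem_set_image.1 <|
    hD (mem_image_of_mem _ ha) (mem_image_of_mem _ hb) (by norm_num) (by norm_num) (by norm_num)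

theorem eq_of_midpointMap_mem_extremePoints {w : W}
    (h : (midpointMap a b w : K.E) ∈ K.carrier.extremePoints ℝ) :
    a w = midpointMap a b w ∧ b w = midpointMap a b w := by
  obtain ⟨ha, hb⟩ := (mem_extremePoints.1 h).2 _ (a w).2 _ (b w).2
    ⟨2⁻¹, 2⁻¹, by norm_num, by norm_num, by norm_num, rfl⟩
  exact ⟨Subtype.ext ha, Subtype.ext hb⟩

theorem IsProxIrrExtension.eq_of_isIrreducibleOver {φ : K → L} (hφ : IsProxIrrExtension φ)
    (ha : IsFlowMap G a) (hb : IsFlowMap G b) (haext : ∀ w, a w ∈ K.extSet)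
    (hbext : ∀ w, b w ∈ K.extSet) (hab : φ ∘ a = φ ∘ b)
    (hirr : IsIrreducibleOver G (φ ∘ a) L.extSet) : a = b := by
  have hmidpoint : K.extSet ⊆ range (midpointMap a b) := by
    refine hφ.extSet_subset_of_meets (isFlowMap_midpointMap ha hb).isSubflow_range fun y hy => ?_
    obtain ⟨w, rfl⟩ := hirr.subset_range hy
    have hbw : b w ∈ fiberHull φ (φ (a w)) := by
      rw [show φ (a w) = φ (b w) from congrFun hab w]
      exact mem_fiberHull_of_mem_extSet (hbext w)
    exact ⟨_, midpointMap_mem convex_fiberHull (mem_fiberHull_of_mem_extSet (haext w)) hbw, w, rfl⟩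
  have hequal : K.extSet ⊆ a '' {w | a w = b w} := by
    refine extSet_subset ((ha.isSubflow_equalizer hb).image ha).isClosed fun x hx => ?_
    obtain ⟨w, rfl⟩ := hmidpoint (mem_extSet_of_mem_extremePoints hx)
    obtain ⟨haw, hbw⟩ := eq_of_midpointMap_mem_extremePoints hx
    exact ⟨w, haw.trans hbw.symm, haw⟩
  refine funext <| eq_univ_iff_forall.1 <| hirr.eq_univ _ (ha.isSubflow_equalizer hb) fun y hy => ?_
  obtain ⟨x, hx, rfl⟩ := hφ.exists_mem_extSet hy
  obtain ⟨w, hw, rfl⟩ := hequal hx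
  exact ⟨w, hw, rfl⟩

end Rigidity

namespace IsAffineIso

variable {φ : K → L}

theorem exists_inverse (hφ : IsAffineIso φ) : ∃ θ : L → K, IsAffineIso θ ∧ φ ∘ θ = id := by
  have hbij : Function.Bijective φ := ⟨hφ.injective, hφ.surjective⟩
  let e : K ≃ L := Equiv.ofBijective φ hbij
  have he : ∀ y, φ (e.symm y) = y := Equiv.ofBijective_apply_symm_apply φ hbij
  refine ⟨e.symm, ⟨⟨Continuous.continuous_symm_of_equiv_compact_to_t2 (f := e) hφ.continuous,
    fun g y => hφ.injective ?_, fun x y z r s hr hs hrs h => ?_, e.symm.surjective⟩,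
    e.symm.injective⟩, funext he⟩
  · rw [hφ.map_smul, he, he]
  · have hcomb := hφ.affine (e.symm x) (e.symm y)
      ⟨_, K.convex (e.symm x).2 (e.symm y).2 hr hs hrs⟩ r s hr hs hrs rfl
    rw [he, he, ← h] at hcomb
    rw [← Subtype.ext hcomb]
    exact congrArg Subtype.val (e.symm_apply_apply _)

theorem comp {ψ : P → K} (hφ : IsAffineIso φ) (hψ : IsAffineIso ψ) : IsAffineIso (φ ∘ ψ) :=
  ⟨hφ.toIsAffineExtension.comp hψ.toIsAffineExtension, hφ.injective.comp hψ.injective⟩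

theorem map_mem_extremePoints (hφ : IsAffineIso φ) {x : K}
    (hx : (x : K.E) ∈ K.carrier.extremePoints ℝ) : (φ x : L.E) ∈ L.carrier.extremePoints ℝ := by
  obtain ⟨θ, hθ, hφθ⟩ := hφ.exists_inverse
  have hpreimage : θ ⁻¹' {x} = {φ x} := by
    ext y
    rw [mem_preimage, mem_singleton_iff, mem_singleton_iff, ← hφ.injective.eq_iff]
    exact iff_of_eq (congrArg (· = φ x) (congrFun hφθ y))
  simpa only [hpreimage, image_singleton, isExtreme_singleton] using
    hθ.affine.isExtreme_preimage hx

end IsAffineIso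

section Uniqueness

theorem IsMaxProxIrrExtension.exists_isAffineIso {K' : AffineFlow G} {φ : K → L} {ψ : K' → L}
    (hφ : IsMaxProxIrrExtension φ) (hψ : IsMaxProxIrrExtension ψ) :
    ∃ η : K → K', IsAffineIso η ∧ ψ ∘ η = φ := by
  obtain ⟨W, p, q, h⟩ := exists_isJoining hφ.1.toIsAffineExtension hψ.1.toIsAffineExtension
  have hleft := hφ.2 _ _ (h.isProxIrrExtension_barycenter hφ.1 hψ.1)
  have hright := hψ.2 _ _ (h.symm.isProxIrrExtension_barycenter hψ.1 hφ.1)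
  obtain ⟨θ, hθ, hinv⟩ := hleft.exists_inverse
  refine ⟨_, hright.comp hθ, ?_⟩
  rw [← Function.comp_assoc,
    ← h.comp_barycenter_eq hφ.1.isContinuousAffine hψ.1.isContinuousAffine,
    Function.comp_assoc, hinv, Function.comp_id]

theorem IsAffineIso.exists_lift_diracProb {X Z : GFlow G} {η : probFlow X → probFlow Z}
    (hη : IsAffineIso η) : ∃ a : X → Z, IsFlowMap G a ∧ diracProb Z ∘ a = η ∘ diracProb X :=
  (hη.isFlowMap.comp isFlowMap_diracProb).exists_lift_diracProb fun x =>
    mem_extremePoints_probFlow.1 (hη.map_mem_extremePoints (diracProb_mem_extremePoints x))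

theorem IsAffineIso.exists_homeomorph {X Z : GFlow G} {η : probFlow X → probFlow Z}
    (hη : IsAffineIso η) : ∃ e : X ≃ₜ Z, ∀ (g : G) (x : X), e (g • x) = g • e x := by
  obtain ⟨a, ha, haη⟩ := hη.exists_lift_diracProb
  obtain ⟨θ, hθ, hηθ⟩ := hη.exists_inverse
  obtain ⟨b, -, hbθ⟩ := hθ.exists_lift_diracProb
  have hinjective : Function.Injective a := by
    refine Function.Injective.of_comp (f := diracProb Z) ?_
    rw [haη]
    exact hη.injective.comp diracProb_injective
  have hsurjective : Function.RightInverse b a := fun z => diracProb_injective <| calc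
    diracProb Z (a (b z)) = η (diracProb X (b z)) := congrFun haη _
    _ = η (θ (diracProb Z z)) := congrArg η (congrFun hbθ z)
    _ = diracProb Z z := congrFun hηθ _
  exact ⟨Continuous.homeoOfEquivCompactToT2
    (f := Equiv.ofBijective a ⟨hinjective, hsurjective.surjective⟩) ha.continuous, ha.map_smul⟩

end Uniqueness

/-- A proximally irreducible extension of `L` by the probability measures on a flow. -/
structure ProxIrrFlow (L : AffineFlow G) where
  flow : GFlow G
  ext : probFlow flow → L
  isProxIrr : IsProxIrrExtension ext

namespace ProxIrrFlow

/-- The restriction of the extension to the Dirac measures. -/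
noncomputable def proj (A : ProxIrrFlow L) : A.flow → L := A.ext ∘ diracProb A.flow

theorem isFlowMap_proj (A : ProxIrrFlow L) : IsFlowMap G A.proj :=
  A.isProxIrr.isFlowMap.comp isFlowMap_diracProb

theorem isIrreducibleOver_proj (A : ProxIrrFlow L) : IsIrreducibleOver G A.proj L.extSet where
  subset_range y hy := by
    obtain ⟨Λ, hΛ, rfl⟩ := A.isProxIrr.exists_mem_extSet hy
    rw [extSet_probFlow] at hΛ
    obtain ⟨x, rfl⟩ := hΛ
    exact ⟨x, rfl⟩
  eq_univ T hT hsurj := by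
    have hsubset : (probFlow A.flow).extSet ⊆ diracProb A.flow '' T :=
      A.isProxIrr.extSet_subset_of_surjOn (hT.image isFlowMap_diracProb) fun y hy => by
        obtain ⟨x, hx, rfl⟩ := hsurj hy
        exact ⟨_, ⟨mem_extSet_of_mem_extremePoints (diracProb_mem_extremePoints x),
          mem_image_of_mem _ hx⟩, rfl⟩
    exact eq_univ_of_forall fun x => diracProb_injective.mem_set_image.1
      (hsubset (mem_extSet_of_mem_extremePoints (diracProb_mem_extremePoints x)))

theorem eq_of_proj_comp_eq (A : ProxIrrFlow L) {W : GFlow G} {f h : W → A.flow}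
    (hf : IsFlowMap G f) (hh : IsFlowMap G h) (heq : A.proj ∘ f = A.proj ∘ h)
    (hirr : IsIrreducibleOver G (A.proj ∘ f) L.extSet) : f = h := by
  have hext : ∀ x, diracProb A.flow x ∈ (probFlow A.flow).extSet := fun x =>
    mem_extSet_of_mem_extremePoints (diracProb_mem_extremePoints x)
  exact diracProb_injective.comp_left <| A.isProxIrr.eq_of_isIrreducibleOver
    (isFlowMap_diracProb.comp hf) (isFlowMap_diracProb.comp hh) (fun w => hext _)
    (fun w => hext _) heq hirr

/-- `A ≤ B` means that there is a morphism of flows over `L` from `B` to `A`. -/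
instance : Preorder (ProxIrrFlow L) where
  le A B := ∃ f : B.flow → A.flow, IsFlowMap G f ∧ A.proj ∘ f = B.proj
  le_refl A := ⟨id, ⟨continuous_id, fun _ _ => rfl⟩, rfl⟩
  le_trans := by
    rintro A B C ⟨f, hf, hfAB⟩ ⟨h, hh, hhBC⟩
    exact ⟨f ∘ h, hf.comp hh, by rw [← Function.comp_assoc, hfAB, hhBC]⟩

section Small

theorem exists_proj_eq (A : ProxIrrFlow L) (y : L.extSet) : ∃ x, A.proj x = y :=
  A.isIrreducibleOver_proj.subset_range y.2

/-- A parametrization of the flow of `A` by a compact space that does not depend on `A`: the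
continuous extension of `(g, y) ↦ g • x` to ultrafilters, where `x` is a chosen point over `y`. -/
noncomputable def cover (A : ProxIrrFlow L) : Ultrafilter (G × L.extSet) → A.flow :=
  Ultrafilter.extend fun d => d.1 • (A.exists_proj_eq d.2).choose

theorem continuous_cover (A : ProxIrrFlow L) : Continuous A.cover :=
  continuous_ultrafilter_extend _

theorem cover_pure (A : ProxIrrFlow L) (d : G × L.extSet) :
    A.cover (pure d) = d.1 • (A.exists_proj_eq d.2).choose :=
  ultrafilter_extend_pure _ _

theorem smul_cover_pure (A : ProxIrrFlow L) (g : G) (d : G × L.extSet) :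
    g • A.cover (pure d) = A.cover (pure (g * d.1, d.2)) := by
  rw [cover_pure, cover_pure, mul_smul]

theorem proj_cover_pure (A : ProxIrrFlow L) (d : G × L.extSet) :
    A.proj (A.cover (pure d)) = d.1 • (d.2 : L) := by
  rw [cover_pure, A.isFlowMap_proj.map_smul, (A.exists_proj_eq d.2).choose_spec]

theorem surjective_cover (A : ProxIrrFlow L) : Function.Surjective A.cover := by
  have hsubflow : IsSubflow G (closure (range (A.cover ∘ pure))) :=
    ⟨isClosed_closure, fun g x hx => map_mem_closure (continuous_const_smul g) hx (by
      rintro _ ⟨d, rfl⟩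
      exact ⟨_, (A.smul_cover_pure g d).symm⟩)⟩
  have huniv := A.isIrreducibleOver_proj.eq_univ _ hsubflow fun y hy =>
    ⟨_, subset_closure (mem_range_self (1, ⟨y, hy⟩)), by
      rw [Function.comp_apply, proj_cover_pure, one_smul]⟩
  exact range_eq_univ.1 <| eq_univ_of_univ_subset <| huniv ▸
    closure_minimal (range_comp_subset_range _ _) (isCompact_range A.continuous_cover).isClosed

theorem le_of_ker_cover_le {A B : ProxIrrFlow L}
    (h : Setoid.ker B.cover ≤ Setoid.ker A.cover) : A ≤ B := by
  have hquot : IsQuotientMap B.cover :=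
    .of_surjective_continuous B.surjective_cover B.continuous_cover
  let f : C(B.flow, A.flow) :=
    IsQuotientMap.lift (f := ⟨B.cover, B.continuous_cover⟩) hquot ⟨A.cover, A.continuous_cover⟩
      fun _ _ hab => h hab
  have hf : ∀ u, f (B.cover u) = A.cover u :=
    DFunLike.congr_fun (IsQuotientMap.lift_comp (f := ⟨B.cover, B.continuous_cover⟩) hquot
      ⟨A.cover, A.continuous_cover⟩ fun _ _ hab => h hab)
  refine ⟨f, ⟨f.continuous, fun g x => ?_⟩, funext fun x => ?_⟩ <;>
    obtain ⟨u, rfl⟩ := B.surjective_cover x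
  · refine congrFun (denseRange_pure.equalizer (f.continuous.comp
      ((continuous_const_smul g).comp B.continuous_cover)) ((continuous_const_smul g).comp
      (f.continuous.comp B.continuous_cover)) (funext fun d => ?_)) u
    simp only [Function.comp_apply, smul_cover_pure, hf]
  · refine congrFun (denseRange_pure.equalizer (A.isFlowMap_proj.continuous.comp
      (f.continuous.comp B.continuous_cover)) (B.isFlowMap_proj.continuous.comp B.continuous_cover)
      (funext fun d => ?_)) u
    simp only [Function.comp_apply, hf, proj_cover_pure]

theorem exists_small_cofinal (L : AffineFlow G) :
    ∃ (I : Type u) (A : I → ProxIrrFlow L), ∀ B, ∃ i, B ≤ A i :=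
  ⟨_, rangeSplitting fun A : ProxIrrFlow L => Setoid.ker A.cover, fun B =>
    ⟨⟨_, mem_range_self B⟩, le_of_ker_cover_le
      (apply_rangeSplitting (fun A : ProxIrrFlow L => Setoid.ker A.cover) _).le⟩⟩

end Small

/-- The flow obtained from an extension of `L` by passing to the closure of the set of extreme
points. -/
noncomputable def ofExtension (hL : L.ComposesProxIrr) {φ : K → L} (hφ : IsProxIrrExtension φ) :
    ProxIrrFlow L where
  flow := K.extFlow
  ext := φ ∘ barycenter K.isFlowMap_val_extFlow.continuous
  isProxIrr := hL _ _ _ _ hφ (isProxIrrExtension_barycenter_extFlow K)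

theorem proj_ofExtension (hL : L.ComposesProxIrr) {φ : K → L} (hφ : IsProxIrrExtension φ)
    (x : K.extFlow) : (ofExtension hL hφ).proj x = φ x :=
  congrArg φ (barycenter_diracProb _ x)

theorem le_of_exists_isFlowMap {A B : ProxIrrFlow L}
    (h : ∃ f : B.flow → probFlow A.flow, IsFlowMap G f ∧ (∀ x, f x ∈ (probFlow A.flow).extSet) ∧
      A.ext ∘ f = B.proj) : A ≤ B := by
  obtain ⟨f, hf, hext, hproj⟩ := h
  rw [extSet_probFlow] at hext
  obtain ⟨a, ha, rfl⟩ := hf.exists_lift_diracProb hext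
  exact ⟨a, ha, hproj⟩

theorem isDirected_le (hL : L.ComposesProxIrr) : IsDirected (ProxIrrFlow L) (· ≤ ·) where
  directed A B := by
    obtain ⟨W, p, q, h⟩ := exists_isJoining A.isProxIrr.toIsAffineExtension
      B.isProxIrr.toIsAffineExtension
    let D : ProxIrrFlow L :=
      ⟨W, _, hL _ _ _ _ A.isProxIrr (h.isProxIrrExtension_barycenter A.isProxIrr B.isProxIrr)⟩
    have hA : A.ext ∘ (fun w => (p w : probFlow A.flow)) = D.proj := funext fun w =>
      congrArg A.ext (barycenter_diracProb h.isFlowMap_val_left.continuous w).symm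
    exact ⟨D, le_of_exists_isFlowMap ⟨_, h.isFlowMap_val_left, fun w => (p w).2, hA⟩,
      le_of_exists_isFlowMap ⟨_, h.symm.isFlowMap_val_left, fun w => (q w).2,
        (funext fun w => (h.comm w).symm).trans hA⟩⟩

section Limit

variable {I : Type u} {A : I → ProxIrrFlow L} {W : GFlow G} {p : ∀ i, W → (A i).flow} {y : W → L}

theorem exists_probMap_eq_diracProb (B : ProxIrrFlow L) {p : W → B.flow} (hp : IsFlowMap G p)
    (hy : Continuous y) (hpy : B.proj ∘ p = y) {C : Set (probFlow W).E}
    (hC : (probFlow W).IsAffineSubflow C)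
    (hmeets : ∀ z ∈ L.extSet, ∃ Λ ∈ fiberHull (barycenter hy) z, (Λ : (probFlow W).E) ∈ C)
    (x : B.flow) :
    ∃ Λ : probFlow W, (Λ : (probFlow W).E) ∈ C ∧ probMap hp.continuous Λ = diracProb B.flow x := by
  refine B.isProxIrr.extSet_subset_of_meets (hC.isSubflow.image (isFlowMap_probMap hp))
    (fun z hz => ?_) (mem_extSet_of_mem_extremePoints (diracProb_mem_extremePoints x))
  obtain ⟨Λ, hΛ, hΛC⟩ := hmeets z hz
  refine ⟨_, mapsTo_fiberHull_probFlow (isContinuousAffine_probMap hp.continuous).affine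
    (fun w hw => ?_) hΛ, Λ, hΛC, rfl⟩
  rw [barycenter_diracProb, ← hpy] at hw
  rw [probMap_diracProb]
  exact ⟨mem_extSet_of_mem_extremePoints (diracProb_mem_extremePoints _), hw⟩

theorem exists_forall_probMap_eq_diracProb [Nonempty I] (hdir : Directed (· ≤ ·) A)
    (hp : ∀ i, IsFlowMap G (p i)) (hy : Continuous y) (hpy : ∀ i, (A i).proj ∘ p i = y)
    (hirr : IsIrreducibleOver G y L.extSet) {C : Set (probFlow W).E}
    (hC : (probFlow W).IsAffineSubflow C)
    (hmeets : ∀ z ∈ L.extSet, ∃ Λ ∈ fiberHull (barycenter hy) z, (Λ : (probFlow W).E) ∈ C)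
    (w : W) :
    ∃ Λ : probFlow W, (Λ : (probFlow W).E) ∈ C ∧
      ∀ i, probMap (hp i).continuous Λ = diracProb (A i).flow (p i w) := by
  let F : I → Set (probFlow W) := fun i =>
    Subtype.val ⁻¹' C ∩ probMap (hp i).continuous ⁻¹' {diracProb (A i).flow (p i w)}
  have hF : ∀ i, IsClosed (F i) := fun i => hC.isSubflow.isClosed.inter
    (isClosed_singleton.preimage (isContinuousAffine_probMap (hp i).continuous).continuous)
  have hmono : ∀ i k, A i ≤ A k → F k ⊆ F i := by
    rintro i k ⟨s, hs, hsproj⟩ Λ ⟨hΛC, hΛ⟩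
    have hsp : s ∘ p k = p i := (A i).eq_of_proj_comp_eq (hs.comp (hp k)) (hp i)
      (by rw [← Function.comp_assoc, hsproj, hpy, hpy])
      (by rwa [← Function.comp_assoc, hsproj, hpy])
    refine ⟨hΛC, ?_⟩
    have hcomp := congrFun (probMap_comp_probMap hs.continuous (hp k).continuous) Λ
    rw [Function.comp_apply, show probMap (hp k).continuous Λ = _ from hΛ, probMap_diracProb,
      ← Function.comp_apply (f := s)] at hcomp
    simp only [hsp] at hcomp
    exact hcomp.symm
  obtain ⟨Λ, hΛ⟩ := IsCompact.nonempty_iInter_of_directed_nonempty_isCompact_isClosed F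
    (fun i j => (hdir i j).imp fun k hk => ⟨hmono i k hk.1, hmono j k hk.2⟩)
    (fun i => (A i).exists_probMap_eq_diracProb (hp i) hy (hpy i) hC hmeets (p i w))
    (fun i => (hF i).isCompact) hF
  rw [mem_iInter] at hΛ
  exact ⟨Λ, (hΛ (Classical.arbitrary I)).1, fun i => (hΛ i).2⟩

theorem isProxIrrExtension_barycenter_of_directed [Nonempty I] (hdir : Directed (· ≤ ·) A)
    (hp : ∀ i, IsFlowMap G (p i)) (hinj : Function.Injective fun w i => p i w)
    (hy : IsFlowMap G y) (hpy : ∀ i, (A i).proj ∘ p i = y)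
    (hirr : IsIrreducibleOver G y L.extSet) :
    IsProxIrrExtension (barycenter hy.continuous) := by
  refine (isAffineExtension_barycenter hy hirr.subset_range).isProxIrrExtension
    fun C hC hmeets Θ hΘ => ?_
  rw [extSet_probFlow] at hΘ
  obtain ⟨w, rfl⟩ := hΘ
  obtain ⟨Λ, hΛC, hΛ⟩ := exists_forall_probMap_eq_diracProb hdir hp hy.continuous hpy hirr hC
    hmeets w
  have hprod : IsContinuousAffine fun Θ : probFlow W =>
      (⟨fun i => probMap (hp i).continuous Θ, fun i _ => (probMap (hp i).continuous Θ).2⟩ :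
        univ.pi fun i => (probFlow (A i).flow).carrier) :=
    .piMk fun i => isContinuousAffine_probMap (hp i).continuous
  obtain ⟨v, rfl⟩ : ∃ v, Λ = diracProb W v := by
    refine hprod.exists_eq_diracProb (fun v v' hvv' => hinj <| funext fun i =>
      diracProb_injective <| Subtype.ext ?_) ?_
    · have hi := congrFun (congrArg Subtype.val hvv') i
      simpa only [Function.comp_apply, probMap_diracProb] using hi
    · rw [extremePoints_pi]
      intro i _
      simp only [hΛ]
      exact diracProb_mem_extremePoints _
  have hv : v = w := hinj <| funext fun i => diracProb_injective <| by
    rw [← hΛ i, probMap_diracProb]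
  rwa [← hv]

theorem bddAbove_range_of_directed [Nonempty I] (hdir : Directed (· ≤ ·) A) :
    BddAbove (range A) := by
  let i₀ : I := Classical.arbitrary I
  let π : (∀ i, (A i).flow) → L := fun v => (A i₀).proj (v i₀)
  have heval : ∀ i, IsFlowMap G fun v : ∀ i, (A i).flow => v i :=
    fun i => ⟨continuous_apply i, fun _ _ => rfl⟩
  have hproj : ∀ i, IsFlowMap G fun v : ∀ i, (A i).flow => (A i).proj (v i) :=
    fun i => (A i).isFlowMap_proj.comp (heval i)
  have hT : IsSubflow G (⋂ i, {v : ∀ i, (A i).flow | (A i).proj (v i) = π v}) :=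
    .iInter fun i => (hproj i).isSubflow_equalizer (hproj i₀)
  have hsurj : L.extSet ⊆ π '' ⋂ i, {v : ∀ i, (A i).flow | (A i).proj (v i) = π v} := fun y hy => by
    choose v hv using fun i => (A i).exists_proj_eq ⟨y, hy⟩
    exact ⟨v, mem_iInter.2 fun i => (hv i).trans (hv i₀).symm, hv i₀⟩
  obtain ⟨W, ι, hι, hinj, hιT, hirr⟩ := exists_isIrreducibleOver (hproj i₀).continuous hT hsurj
  have hy : IsFlowMap G (π ∘ ι) := (hproj i₀).comp hι
  let B : ProxIrrFlow L := ⟨W, barycenter hy.continuous, isProxIrrExtension_barycenter_of_directed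
    hdir (p := fun i w => ι w i) (fun i => (heval i).comp hι) hinj hy
    (fun i => funext fun w => mem_iInter.1 (hιT w) i) hirr⟩
  refine ⟨B, forall_mem_range.2 fun i => ⟨fun w => ι w i, (heval i).comp hι, funext fun w => ?_⟩⟩
  exact (mem_iInter.1 (hιT w) i).trans (barycenter_diracProb hy.continuous w).symm

end Limit

theorem exists_isTop (hL : L.ComposesProxIrr) : ∃ M : ProxIrrFlow L, IsTop M := by
  have := isDirected_le hL
  have : Nonempty (ProxIrrFlow L) := ⟨⟨_, _, isProxIrrExtension_barycenter_extFlow L⟩⟩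
  obtain ⟨I, A, hA⟩ := exists_small_cofinal L
  have : Nonempty I := (hA (Classical.arbitrary _)).nonempty
  have hdir : Directed (· ≤ ·) A := fun i j => by
    obtain ⟨B, hi, hj⟩ := exists_ge_ge (A i) (A j)
    obtain ⟨k, hk⟩ := hA B
    exact ⟨k, hi.trans hk, hj.trans hk⟩
  obtain ⟨M, hM⟩ := bddAbove_range_of_directed hdir
  exact ⟨M, fun B => (hA B).elim fun i hi => hi.trans (hM (mem_range_self i))⟩

theorem isMaxProxIrrExtension_ext (hL : L.ComposesProxIrr) {M : ProxIrrFlow L} (hM : IsTop M) :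
    IsMaxProxIrrExtension M.ext := by
  refine ⟨M.isProxIrr, fun P ψ hψ => ⟨hψ.toIsAffineExtension, ?_⟩⟩
  have hθ : IsProxIrrExtension (M.ext ∘ ψ) := hL _ _ _ _ M.isProxIrr hψ
  obtain ⟨f, hf, hfproj⟩ : ∃ f : M.flow → P.extFlow,
    IsFlowMap G f ∧ (ofExtension hL hθ).proj ∘ f = M.proj := hM (ofExtension hL hθ)
  let b : M.flow → P := fun x => f x
  have hb : IsFlowMap G b := P.isFlowMap_val_extFlow.comp hf
  have hproj : (M.ext ∘ ψ) ∘ b = M.proj := by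
    rw [← hfproj]
    exact funext fun x => (proj_ofExtension hL hθ (f x)).symm
  have hψb : ψ ∘ b = diracProb M.flow :=
    M.isProxIrr.eq_of_isIrreducibleOver (hψ.isFlowMap.comp hb) isFlowMap_diracProb
      (fun x => hψ.mapsTo_extSet (f x).2)
      (fun x => mem_extSet_of_mem_extremePoints (diracProb_mem_extremePoints x)) hproj
      (by rw [← Function.comp_assoc, hproj]; exact M.isIrreducibleOver_proj)
  have hsurj : Function.Surjective (barycenter hb.continuous) :=
    (isAffineExtension_barycenter hb (hθ.extSet_subset_range hb
      (fun x => (f x).2) (by rw [hproj]; exact M.isIrreducibleOver_proj.subset_range))).surjective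
  have hinv : Function.LeftInverse ψ (barycenter hb.continuous) := congrFun <|
    (hψ.isContinuousAffine.comp (isContinuousAffine_barycenter _)).eq_of_comp_diracProb_eq
      ⟨continuous_id, fun _ _ _ _ _ _ _ _ h => h⟩ <| funext fun x =>
        (congrArg ψ (barycenter_diracProb hb.continuous x)).trans (congrFun hψb x)
  exact (hinv.rightInverse_of_surjective hsurj).injective

end ProxIrrFlow

theorem exists_isMaxProxIrrExtension (hL : L.ComposesProxIrr) :
    ∃ (X : GFlow G) (φ : probFlow X → L), IsMaxProxIrrExtension φ := by
  obtain ⟨M, hM⟩ := ProxIrrFlow.exists_isTop hL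
  exact ⟨_, _, ProxIrrFlow.isMaxProxIrrExtension_ext hL hM⟩

section Ulim

/-- The limit of the translates `g • x` along an ultrafilter on the group. As a function of `x` it
is affine, but not continuous. -/
noncomputable def ulim (𝒰 : Ultrafilter G) (x : K) : K := Ultrafilter.extend (fun g => g • x) 𝒰

variable (𝒰 : Ultrafilter G)

theorem tendsto_ulim (x : K) : Filter.Tendsto (fun g : G => g • x) 𝒰 (𝓝 (ulim 𝒰 x)) :=
  ultrafilter_extend_eq_iff.1 rfl

theorem preservesConvexComb_ulim : PreservesConvexComb (ulim (K := K) 𝒰) := by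
  intro x y z a b ha hb hab h
  have hlim : ∀ w : K, Filter.Tendsto (fun g : G => ((g • w : K) : K.E)) 𝒰 (𝓝 (ulim 𝒰 w)) :=
    fun w => (continuous_subtype_val.tendsto _).comp (tendsto_ulim 𝒰 w)
  exact tendsto_nhds_unique (hlim z) ((((hlim x).const_smul a).add ((hlim y).const_smul b)).congr
    fun g => (K.affine g x y z a b ha hb hab h).symm)

theorem map_ulim {φ : K → L} (hφ : IsFlowMap G φ) (x : K) :
    φ (ulim 𝒰 x) = ulim 𝒰 (φ x) :=
  tendsto_nhds_unique ((hφ.continuous.tendsto _).comp (tendsto_ulim 𝒰 x))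
    ((tendsto_ulim 𝒰 (φ x)).congr fun g => (hφ.map_smul g x).symm)

theorem ulim_mem {D : Set K} (hD : IsSubflow G D) {x : K} (hx : x ∈ D) :
    ulim 𝒰 x ∈ D :=
  hD.isClosed.mem_of_tendsto (tendsto_ulim 𝒰 x) (.of_forall fun g => hD.smul_mem g x hx)

theorem mapsTo_ulim_fiberHull {φ : K → L} (hφ : IsFlowMap G φ) (y : L) :
    MapsTo (ulim 𝒰) (fiberHull φ y) (fiberHull φ (ulim 𝒰 y)) :=
  mapsTo_fiberHull (preservesConvexComb_ulim 𝒰) (fun _ hx => ulim_mem 𝒰 K.isSubflow_extSet hx)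
    fun x _ hxy => by rw [map_ulim 𝒰 hφ, hxy]

theorem exists_ulim_eq {x z : K} (hz : z ∈ closure (MulAction.orbit G x)) :
    ∃ 𝒰 : Ultrafilter G, ulim 𝒰 x = z := by
  have : (Filter.comap (fun g : G => g • x) (𝓝 z)).NeBot :=
    Filter.comap_neBot_iff_frequently.2 (mem_closure_iff_frequently.1 hz)
  exact ⟨.of _, tendsto_nhds_unique (tendsto_ulim _ x)
    (Filter.tendsto_comap.mono_left (Ultrafilter.of_le _))⟩

end Ulim

theorem IsProxIrrExtension.extSet_subset_closure_orbit {φ : K → L} (hφ : IsProxIrrExtension φ)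
    {y : L} (hy : L.extSet ⊆ closure (MulAction.orbit G y)) {x : K} (hx : x ∈ fiberHull φ y) :
    K.extSet ⊆ closure (MulAction.orbit G x) :=
  hφ.extSet_subset_of_meets (isSubflow_closure_orbit x) fun z hz => by
    obtain ⟨𝒰, rfl⟩ := exists_ulim_eq (hy hz)
    exact ⟨ulim 𝒰 x, mapsTo_ulim_fiberHull 𝒰 hφ.isFlowMap y hx,
      ulim_mem 𝒰 (isSubflow_closure_orbit x) (subset_closure (MulAction.mem_orbit_self x))⟩

theorem mem_fiberHull_of_map_mem_extremePoints {P : AffineFlow G} {φ : K → L} {ψ : K → P}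
    (hψ : PreservesConvexComb ψ) {x : K} {y : L} (hx : x ∈ fiberHull φ y)
    (hψx : (ψ x : P.E) ∈ P.carrier.extremePoints ℝ) : x ∈ fiberHull ψ (ψ x) := by
  refine convexHull_mono (image_mono ?_) (hψ.mem_convexHull_fiber K.convex hx hψx)
  exact fun _ hz => ⟨hz.1.1, hz.2⟩

theorem composesProxIrr_of_extSet_subset_closure_orbit {y : L}
    (hy : (y : L.E) ∈ L.carrier.extremePoints ℝ)
    (horbit : L.extSet ⊆ closure (MulAction.orbit G y)) : L.ComposesProxIrr := by
  intro K P φ ψ hφ hψ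
  have hφψ := hφ.toIsAffineExtension.comp hψ.toIsAffineExtension
  refine hφψ.isProxIrrExtension fun C hC hmeets => ?_
  obtain ⟨x, hx, rfl⟩ :=
    hφ.isContinuousAffine.exists_extremePoint K.isCompact hy (hφ.surjective y)
  obtain ⟨w, hw, hwC⟩ := hmeets _ (mem_extSet_of_mem_extremePoints hy)
  have hψw : ψ w ∈ fiberHull φ (φ x) :=
    mapsTo_fiberHull hψ.affine hψ.mapsTo_extSet (fun _ _ h => h) hw
  obtain ⟨𝒰, h𝒰⟩ := exists_ulim_eq
    (hφ.extSet_subset_closure_orbit horbit hψw (mem_extSet_of_mem_extremePoints hx))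
  rw [← map_ulim 𝒰 hψ.isFlowMap] at h𝒰
  have hulim : ulim 𝒰 w ∈ fiberHull ψ x := h𝒰 ▸
    mem_fiberHull_of_map_mem_extremePoints hψ.affine
      (mapsTo_ulim_fiberHull 𝒰 hφψ.isFlowMap _ hw) (h𝒰 ▸ hx)
  have horbit' : P.extSet ⊆ closure (MulAction.orbit G (ulim 𝒰 w)) :=
    hψ.extSet_subset_closure_orbit (hφ.extSet_subset_closure_orbit horbit
      (mem_fiberHull_of_mem_extSet (mem_extSet_of_mem_extremePoints hx))) hulim
  refine horbit'.trans (closure_minimal ?_ hC.isSubflow.isClosed)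
  rintro _ ⟨g, rfl⟩
  exact hC.isSubflow.smul_mem g _ (ulim_mem 𝒰 hC.isSubflow hwC)

theorem composesProxIrr_of_isEmpty [IsEmpty L] : L.ComposesProxIrr := fun _ _ φ ψ hφ hψ =>
  ⟨hφ.toIsAffineExtension.comp hψ.toIsAffineExtension, fun _ hC _ =>
    hC.nonempty.elim fun x hx => isEmptyElim (φ (ψ ⟨x, hC.subset hx⟩))⟩

end AffineFlow

section ProbFlow

variable {G : Type u} [Group G] [TopologicalSpace G] {Y : GFlow G}

theorem composesProxIrr_probFlow_of_dense_orbit {y : Y} (hy : Dense (MulAction.orbit G y)) :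
    (probFlow Y).ComposesProxIrr := by
  refine AffineFlow.composesProxIrr_of_extSet_subset_closure_orbit
    (diracProb_mem_extremePoints y) ?_
  rw [extSet_probFlow]
  rintro _ ⟨x, rfl⟩
  refine map_mem_closure isFlowMap_diracProb.continuous (hy x) ?_
  rintro _ ⟨g, rfl⟩
  exact ⟨g, (isFlowMap_diracProb.map_smul g y).symm⟩

theorem composesProxIrr_probFlow_of_isEmpty [IsEmpty Y] : (probFlow Y).ComposesProxIrr := by
  have : IsEmpty (probFlow Y) := by
    rw [← not_nonempty_iff]
    intro
    obtain ⟨_, hΛ⟩ := AffineFlow.extSet_nonempty (K := probFlow Y)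
    rw [extSet_probFlow] at hΛ
    exact hΛ.elim fun x _ => isEmptyElim x
  exact AffineFlow.composesProxIrr_of_isEmpty

theorem isEmpty_or_exists_dense_orbit
    (hY : MulAction.IsMinimal G Y ∨ ∃ y : Y, MulAction.orbit G y ∈ residual Y) :
    IsEmpty Y ∨ ∃ y : Y, Dense (MulAction.orbit G y) := by
  obtain hmin | ⟨y, hy⟩ := hY
  · exact (isEmpty_or_nonempty Y).imp_right fun ⟨y⟩ => ⟨y, MulAction.dense_orbit G y⟩
  · exact .inr ⟨y, dense_of_mem_residual hy⟩

end ProbFlow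

theorem mainTheorem9_general {G : Type u} [Group G] [TopologicalSpace G] :
    (∀ L : AffineFlow G, L.ComposesProxIrr →
      ∃ (X : GFlow G) (φ : probFlow X → L), AffineFlow.IsMaxProxIrrExtension φ) ∧
    (∀ (L K K' : AffineFlow G) (φ : K → L) (ψ : K' → L),
      AffineFlow.IsMaxProxIrrExtension φ → AffineFlow.IsMaxProxIrrExtension ψ →
      ∃ η : K → K', AffineFlow.IsAffineIso η ∧ ψ ∘ η = φ) ∧
    (∀ (L : AffineFlow G) (X Z : GFlow G) (φ : probFlow X → L) (ψ : probFlow Z → L),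
      AffineFlow.IsMaxProxIrrExtension φ → AffineFlow.IsMaxProxIrrExtension ψ →
      ∃ e : X ≃ₜ Z, ∀ (g : G) (x : X), e (g • x) = g • e x) ∧
    (∀ Y : GFlow G, IsEmpty Y ∨ (∃ y : Y, Dense (MulAction.orbit G y)) →
      (probFlow Y).ComposesProxIrr) := by
  refine ⟨fun L hL => AffineFlow.exists_isMaxProxIrrExtension hL,
    fun L K K' φ ψ hφ hψ => hφ.exists_isAffineIso hψ, fun L X Z φ ψ hφ hψ => ?_, fun Y hY => ?_⟩
  · obtain ⟨η, hη, -⟩ := hφ.exists_isAffineIso hψ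
    exact hη.exists_homeomorph
  · obtain hempty | ⟨y, hy⟩ := hY
    · exact composesProxIrr_probFlow_of_isEmpty
    · exact composesProxIrr_probFlow_of_dense_orbit hy

theorem mainTheorem9 {G : Type u} [Group G] [TopologicalSpace G] [IsTopologicalGroup G]
    [PolishSpace G] :
    -- existence of a maximal proximally irreducible extension, of the form `P(X)`
    (∀ L : AffineFlow G, L.ComposesProxIrr →
      ∃ (X : GFlow G) (φ : probFlow X → L), AffineFlow.IsMaxProxIrrExtension φ) ∧
    -- uniqueness, up to an isomorphism over `L`
    (∀ (L K K' : AffineFlow G) (φ : K → L) (ψ : K' → L),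
      AffineFlow.IsMaxProxIrrExtension φ → AffineFlow.IsMaxProxIrrExtension ψ →
      ∃ η : K → K', AffineFlow.IsAffineIso η ∧ ψ ∘ η = φ) ∧
    -- uniqueness of the flow `X`, up to isomorphism
    (∀ (L : AffineFlow G) (X Z : GFlow G) (φ : probFlow X → L) (ψ : probFlow Z → L),
      AffineFlow.IsMaxProxIrrExtension φ → AffineFlow.IsMaxProxIrrExtension ψ →
      ∃ e : X ≃ₜ Z, ∀ (g : G) (x : X), e (g • x) = g • e x) ∧
    -- the hypothesis holds for `P(Y)` when `Y` is minimal or has a comeager orbit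
    (∀ Y : GFlow G,
      MulAction.IsMinimal G Y ∨ (∃ y : Y, MulAction.orbit G y ∈ residual Y) →
      (probFlow Y).ComposesProxIrr) := by
  obtain ⟨hexists, hiso, hhomeo, hcomposes⟩ := mainTheorem9_general (G := G)
  exact ⟨hexists, hiso, hhomeo, fun Y hY => hcomposes Y (isEmpty_or_exists_dense_orbit hY)⟩
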